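/- All algebras are unital and complex. Sweedler notation is used for coproducts and $a\mapsto a^{(1)}\otimes a^{(2)}$ for coactions. **Setting.** A *compact matrix quantum group* $G$ with fundamental unitary $U=(u_{ij})_{i,j=1}^m$ is a Hopf $*$-algebra $\mathbb C[G]$ generated as a $*$-algebra by the elements $u_{ij}$, such that $U$ is a unitary corepresentation matrix ($\Delta(u_{ij})=\sum_k u_{ik}\otimes u_{kj}$, $\varepsilon(u_{ij})=\delta_{ij}$) and $\bar U=(u_{ij}^*)_{i,j}$ is equivalent to a unitary corepresentation matrix, i.e. $F\bar UF^{-1}$ is one for some $F\in GL_m(\mathbb C)$. Let $T$ be a compact abelian group with dual group $\hat T$, identify $\mathbb C[T]$ with the group Hopf $*$-algebra $\mathbb C\hat T$, let $\beta\colon\hat T\times\hat T\to\mathbb T$ be a bicharacter, extended bilinearly to $\mathbb C[T]$, and let $\pi\colon\mathbb C[G]\to\mathbb C[T]$ be a Hopf $*$-algebra map. For $a,b\in\hat T$ let $\mathbb C[G]_{a,b}$ be the space of $x$ with $\pi(x_{(1)})\otimes x_{(2)}=a\otimes x$ and $x_{(1)}\otimes\pi(x_{(2)})=x\otimes b$;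 then $\mathbb C[G]=\bigoplus_{a,b}\mathbb C[G]_{a,b}$. The *transmutation* $\mathbb C[G]_\beta$ is the vector space $\mathbb C[G]$ with its original unit, coproduct and counit, with the coaction $x\mapsto x_{(2)}\otimes\pi(S(x_{(1)})x_{(3)})$ of $\mathbb C[T]$, and with product, antipode and involution determined, for $x\in\mathbb C[G]_{a,b}$ and $y\in\mathbb C[G]_{c,d}$, by $$x\cdot_\beta y=\beta(a^{-1}b,c^{-1})\,xy,\qquad S_\beta(x)=\beta(a^{-1}b,b)\,S(x),\qquad x^{*_\beta}=\beta(a^{-1}b,a^{-1})\,x^* .$$ **Braided objects.** The form $\beta$ is a unitary coquasitriangular structure on $\mathbb C[T]$ and makes the category of right $\mathbb C[T]$-comodules braided by $m\otimes n\mapsto\beta(m^{(2)},n^{(2)})\,n^{(1)}\otimes m^{(1)}$. For $\mathbb C[T]$-comodule $*$-algebras $A,B$, the $*$-algebra $A\otimes_\beta B$ is $A\otimes B$ with $(a\otimes b)(a'\otimes b')=\beta(b^{(2)},a'^{(2)})\,aa'^{(1)}\otimes b^{(1)}b'$ and $(a\otimes b)^*=(1\otimes b^*)(a^*\otimes 1)$.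 A *braided Hopf $*$-algebra* over $(\mathbb C[T],\beta)$ is a $\mathbb C[T]$-comodule $*$-algebra $A$ with $\mathbb C[T]$-comodule maps $\Delta_A\colon A\to A\otimes_\beta A$, $\varepsilon_A\colon A\to\mathbb C$ and $S_A\colon A\to A$ satisfying coassociativity, the counit and the antipode identities, where $\Delta_A$ and $\varepsilon_A$ are unital $*$-homomorphisms. Put $\mathbb C[T]\# A=\mathbb C[T]\otimes_\beta A$, with $\mathbb C[T]$ coacting on itself by its coproduct. For $Z=(z_{ij})\in\mathrm{Mat}_m(\mathbb C[T])$ and $V=(v_{ij})\in\mathrm{Mat}_m(A)$, put $\delta_Z(e_j)=\sum_i e_i\otimes z_{ij}$ and $\delta_V(e_j)=\sum_i e_i\otimes v_{ij}$ on $M=\mathbb C^m$. The pair $(Z,V)$ *defines an $A$-comodule* if $\delta_Z$ is a right $\mathbb C[T]$-comodule structure, $\delta_V$ is a right comodule structure for the coalgebra $A$, and $\delta_V\colon M\to M\otimes A$ is a map of $\mathbb C[T]$-comodules. This comodule is *unitary* if moreover the matrix $\bigl(\sum_k z_{ik}\# v_{kj}\bigr)_{i,j}$ is unitary over $\mathbb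 C[T]\# A$, and *unitarizable* if $(FZF^{-1},FVF^{-1})$ defines a unitary $A$-comodule for some $F\in GL_m(\mathbb C)$. A *braided compact matrix quantum group* over $(T,Z,\beta)$ with fundamental unitary $V$, where $Z\in\mathrm{Mat}_m(\mathbb C[T])$ is a unitary corepresentation matrix, is a braided Hopf $*$-algebra $A$ over $(\mathbb C[T],\beta)$ that is generated as a $*$-algebra by the $v_{ij}$, such that - (i) $(Z,V)$ defines a unitary $A$-comodule; - (ii) $(\bar Z,\bar V_Z)$ defines a unitarizable $A$-comodule, where $\bar Z=(z_{ij}^*)_{i,j}$ and $\bar V_Z$ has entries $\sum_{s,l,t}\beta(z_{tj}^*z_{sl},z_{il}^*)\,v_{st}^*$ (involution of $A$). **Proposition.** Let $G$ be a compact matrix quantum group with fundamental unitary $U=(u_{ij})_{i,j=1}^m$. Assume that $T$ is a compact abelian group with a Hopf $*$-algebra map $\pi\colon\mathbb C[G]\to\mathbb C[T]$, and let $\beta$ be a bicharacter on $\hat T$. Then the transmutation $\mathbb C[G]_\beta$ is a braided compact matrix quantum group over $(T,\pi(U),\beta)$ with fundamental unitary $U$. -/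

import Mathlib

open scoped TensorProduct

noncomputable section

namespace BraidedQG

open TensorProduct

universe u v w

/-! ### The group Hopf `*`-algebra -/

section GroupAlgebra

variable {G : Type*} [Group G]

/-- The involution of the complex group algebra: `(r g)^* = conj(r) g⁻¹`. -/
instance instStarMonoidAlgebra : Star (MonoidAlgebra ℂ G) where
  star x := x.coeff.sum fun g r => MonoidAlgebra.single g⁻¹ (star r)

theorem star_def (x : MonoidAlgebra ℂ G) :
    star x = x.coeff.sum fun g r => MonoidAlgebra.single g⁻¹ (star r) := rfl

theorem star_single (g : G) (r : ℂ) :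
    star (MonoidAlgebra.single g r) = MonoidAlgebra.single g⁻¹ (star r) := by
  rw [star_def, MonoidAlgebra.coeff_single, Finsupp.sum_single_index (by simp)]

theorem star_add_monoidAlgebra (x y : MonoidAlgebra ℂ G) : star (x + y) = star x + star y := by
  classical
  simp only [star_def, MonoidAlgebra.coeff_add]
  exact Finsupp.sum_add_index' (by simp) (by simp)

instance instStarRingMonoidAlgebra : StarRing (MonoidAlgebra ℂ G) where
  star_involutive x := by
    induction x using MonoidAlgebra.induction_linear with
    | zero => simp [star_def]
    | add x y hx hy => rw [star_add_monoidAlgebra, star_add_monoidAlgebra, hx, hy]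
    | single g r => simp [star_single]
  star_mul x y := by
    induction x using MonoidAlgebra.induction_linear with
    | zero => simp [star_def]
    | add x x' hx hx' => simp only [add_mul, mul_add, star_add_monoidAlgebra, hx, hx']
    | single g r =>
      induction y using MonoidAlgebra.induction_linear with
      | zero => simp [star_def]
      | add y y' hy hy' => simp only [add_mul, mul_add, star_add_monoidAlgebra, hy, hy']
      | single h s => simp [star_single, mul_comm]
  star_add := star_add_monoidAlgebra

instance instStarModuleMonoidAlgebra : StarModule ℂ (MonoidAlgebra ℂ G) where
  star_smul c x := by
    induction x using MonoidAlgebra.induction_linear with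
    | zero => simp
    | add x y hx hy => simp only [smul_add, star_add, hx, hy]
    | single g r => simp [star_single]

end GroupAlgebra

/-- The Hopf `*`-algebra `ℂ[T]` of a compact abelian group `T`, identified with the group Hopf
`*`-algebra of the dual discrete group (the characters of `T` form a basis of `ℂ[T]`). -/
abbrev FunctionAlgebra (T : Type v) [CommGroup T] [TopologicalSpace T] : Type v :=
  MonoidAlgebra ℂ (PontryaginDual T)

/-- The linear extension to `ℂ[Γ]`, in both variables, of a function `f : Γ × Γ → ℂ`. -/
def bilinExtend {Γ : Type v} (f : Γ → Γ → ℂ) :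
    MonoidAlgebra ℂ Γ →ₗ[ℂ] MonoidAlgebra ℂ Γ →ₗ[ℂ] ℂ :=
  (MonoidAlgebra.basis Γ ℂ).constr ℂ fun a => (MonoidAlgebra.basis Γ ℂ).constr ℂ fun b => f a b

theorem bilinExtend_single {Γ : Type v} (f : Γ → Γ → ℂ) (a b : Γ) :
    bilinExtend f (MonoidAlgebra.single a 1) (MonoidAlgebra.single b 1) = f a b := by
  rw [bilinExtend, ← MonoidAlgebra.basis_apply, ← MonoidAlgebra.basis_apply,
    Module.Basis.constr_basis, Module.Basis.constr_basis]

/-- The bilinear form on `ℂ[Γ]` defined by a bicharacter on `Γ`. -/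
def bicharForm {Γ : Type v} [CommGroup Γ] (β : Γ →* Γ →* Circle) :
    MonoidAlgebra ℂ Γ →ₗ[ℂ] MonoidAlgebra ℂ Γ →ₗ[ℂ] ℂ :=
  bilinExtend fun a b => (β a b : ℂ)

/-! ### Corepresentation matrices and compact matrix quantum groups -/

/-- The matrix `F U F⁻¹` for an invertible scalar matrix `F`. -/
def scalarConj {m : ℕ} {V : Type*} [AddCommGroup V] [Module ℂ V]
    (F : GL (Fin m) ℂ) (U : Matrix (Fin m) (Fin m) V) : Matrix (Fin m) (Fin m) V :=
  fun i j => ∑ k, ∑ l, (F.1 i k * (F⁻¹).1 l j) • U k l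

section CMQG

variable {H : Type u} [Ring H] [HopfAlgebra ℂ H] [StarRing H] [StarModule ℂ H]

/-- The compatibility of the coproduct with the involution, which makes a Hopf algebra with an
involution into a Hopf `*`-algebra. -/
def IsHopfStar (H : Type u) [Ring H] [HopfAlgebra ℂ H] [StarRing H] [StarModule ℂ H] : Prop :=
  ∀ x : H, Coalgebra.comul (R := ℂ) (star x) = star (Coalgebra.comul (R := ℂ) x)

/-- `U` is a corepresentation matrix:
`Δ(u_{ij}) = ∑_k u_{ik} ⊗ u_{kj}` and `ε(u_{ij}) = δ_{ij}`. -/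
structure IsCorepMatrix {m : ℕ} (U : Matrix (Fin m) (Fin m) H) : Prop where
  comul_eq : ∀ i j, Coalgebra.comul (R := ℂ) (U i j) = ∑ k, U i k ⊗ₜ[ℂ] U k j
  counit_eq : ∀ i j, Coalgebra.counit (R := ℂ) (U i j) = if i = j then 1 else 0

/-- A unitary corepresentation matrix. -/
structure IsUnitaryCorepMatrix {m : ℕ} (U : Matrix (Fin m) (Fin m) H) : Prop
    extends IsCorepMatrix U where
  mem_unitary : U ∈ unitary (Matrix (Fin m) (Fin m) H)

/-- The Hopf `*`-algebra `H = ℂ[G]` is a compact matrix quantum group with fundamental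
unitary `U`. -/
structure IsCompactMatrixQuantumGroup {m : ℕ} (U : Matrix (Fin m) (Fin m) H) : Prop where
  hopfStar : IsHopfStar H
  generates : StarAlgebra.adjoin ℂ (Set.range fun p : Fin m × Fin m => U p.1 p.2) = ⊤
  unitary_corep : IsUnitaryCorepMatrix U
  conj_equiv_unitary : ∃ F : GL (Fin m) ℂ, IsUnitaryCorepMatrix (scalarConj F (U.map star))

end CMQG

/-! ### Comodules, the braiding, and braided tensor products -/

section Comodules

/-- `δ : M → M ⊗ C` is a right comodule for the coproduct `Δ` and the counit `e` on `C`. -/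
structure IsRightComodule {C M : Type*} [AddCommGroup C] [Module ℂ C] [AddCommGroup M] [Module ℂ M]
    (Δ : C →ₗ[ℂ] C ⊗[ℂ] C) (e : C →ₗ[ℂ] ℂ) (δ : M →ₗ[ℂ] M ⊗[ℂ] C) : Prop where
  coassoc : ∀ x, TensorProduct.assoc ℂ M C C (δ.rTensor C (δ x)) = Δ.lTensor M (δ x)
  counit : ∀ x, TensorProduct.rid ℂ M (e.lTensor M (δ x)) = x

variable {K : Type v} [Ring K] [HopfAlgebra ℂ K]
  {M N : Type*} [AddCommGroup M] [Module ℂ M] [AddCommGroup N] [Module ℂ N]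

/-- The tensor product coaction `m ⊗ n ↦ m⁽¹⁾ ⊗ n⁽¹⁾ ⊗ m⁽²⁾ n⁽²⁾`. -/
def tensorCoact (δM : M →ₗ[ℂ] M ⊗[ℂ] K) (δN : N →ₗ[ℂ] N ⊗[ℂ] K) :
    M ⊗[ℂ] N →ₗ[ℂ] (M ⊗[ℂ] N) ⊗[ℂ] K :=
  (LinearMap.mul' ℂ K).lTensor (M ⊗[ℂ] N) ∘ₗ
    (TensorProduct.tensorTensorTensorComm ℂ M K N K).toLinearMap ∘ₗ TensorProduct.map δM δN

/-- The braiding `m ⊗ n ↦ R(m⁽²⁾, n⁽²⁾) n⁽¹⁾ ⊗ m⁽¹⁾`. -/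
def braiding (R : K →ₗ[ℂ] K →ₗ[ℂ] ℂ) (δM : M →ₗ[ℂ] M ⊗[ℂ] K) (δN : N →ₗ[ℂ] N ⊗[ℂ] K) :
    M ⊗[ℂ] N →ₗ[ℂ] N ⊗[ℂ] M :=
  (TensorProduct.rid ℂ (N ⊗[ℂ] M)).toLinearMap ∘ₗ
    TensorProduct.map (TensorProduct.comm ℂ M N).toLinearMap (TensorProduct.lift R) ∘ₗ
    (TensorProduct.tensorTensorTensorComm ℂ M K N K).toLinearMap ∘ₗ TensorProduct.map δM δN

end Comodules

section Coquasitriangular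

variable {K : Type v} [Ring K] [HopfAlgebra ℂ K] [StarRing K] [StarModule ℂ K]

/-- The form `(x, y) ↦ conj(R(x^*, y^*))`. -/
def conjForm (R : K →ₗ[ℂ] K →ₗ[ℂ] ℂ) : K ⊗[ℂ] K →ₗ[ℂ] ℂ :=
  (starLinearEquiv ℂ (A := ℂ)).toLinearMap ∘ₛₗ TensorProduct.lift R ∘ₛₗ
    (starLinearEquiv ℂ (A := K ⊗[ℂ] K)).toLinearMap

/-- `x ⊗ y ↦ (x₍₁₎ ⊗ y₍₁₎) ⊗ (x₍₂₎ ⊗ y₍₂₎)`. -/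
def comul₂ (K : Type v) [Ring K] [HopfAlgebra ℂ K] :
    K ⊗[ℂ] K →ₗ[ℂ] (K ⊗[ℂ] K) ⊗[ℂ] (K ⊗[ℂ] K) :=
  (TensorProduct.tensorTensorTensorComm ℂ K K K K).toLinearMap ∘ₗ
    TensorProduct.map Coalgebra.comul Coalgebra.comul

/-- `R` is a unitary coquasitriangular structure on `K`. -/
structure IsUnitaryCoquasitriangular (R : K →ₗ[ℂ] K →ₗ[ℂ] ℂ) : Prop where
  /-- `R(xy, z) = R(x, z₍₁₎) R(y, z₍₂₎)` -/
  mul_left : ∀ x y z, R (x * y) z =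
    LinearMap.mul' ℂ ℂ (TensorProduct.map (R x) (R y) (Coalgebra.comul z))
  /-- `R(x, yz) = R(x₍₁₎, z) R(x₍₂₎, y)` -/
  mul_right : ∀ x y z, R x (y * z) =
    LinearMap.mul' ℂ ℂ (TensorProduct.map (R.flip z) (R.flip y) (Coalgebra.comul x))
  /-- `y₍₁₎ x₍₁₎ R(x₍₂₎, y₍₂₎) = R(x₍₁₎, y₍₁₎) x₍₂₎ y₍₂₎` -/
  comm : ∀ x y : K,
    TensorProduct.rid ℂ K (TensorProduct.map
      (LinearMap.mul' ℂ K ∘ₗ (TensorProduct.comm ℂ K K).toLinearMap) (TensorProduct.lift R)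
      (comul₂ K (x ⊗ₜ y))) =
    TensorProduct.lid ℂ K (TensorProduct.map (TensorProduct.lift R) (LinearMap.mul' ℂ K)
      (comul₂ K (x ⊗ₜ y)))
  /-- `(x, y) ↦ conj(R(x^*, y^*))` is a right convolution inverse of `R` -/
  conv_conj : ∀ x y : K,
    LinearMap.mul' ℂ ℂ (TensorProduct.map (TensorProduct.lift R) (conjForm R)
      (comul₂ K (x ⊗ₜ y))) = Coalgebra.counit (R := ℂ) x * Coalgebra.counit (R := ℂ) y
  /-- `(x, y) ↦ conj(R(x^*, y^*))` is a left convolution inverse of `R` -/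
  conj_conv : ∀ x y : K,
    LinearMap.mul' ℂ ℂ (TensorProduct.map (conjForm R) (TensorProduct.lift R)
      (comul₂ K (x ⊗ₜ y))) = Coalgebra.counit (R := ℂ) x * Coalgebra.counit (R := ℂ) y

end Coquasitriangular

/-- The operations of a right `K`-comodule `*`-algebra on the vector space `A`
(the laws are in `IsComoduleStarAlgebra`). -/
structure ComoduleStarAlgebraData (K : Type v) [Ring K] [HopfAlgebra ℂ K]
    (A : Type u) [AddCommGroup A] [Module ℂ A] where
  mul : A ⊗[ℂ] A →ₗ[ℂ] A
  one : A
  star : A →ₗ⋆[ℂ] A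
  coact : A →ₗ[ℂ] A ⊗[ℂ] K

section ComoduleStarAlgebra

variable {K : Type v} [Ring K] [HopfAlgebra ℂ K] [StarRing K] [StarModule ℂ K]
  {A : Type u} [AddCommGroup A] [Module ℂ A] {B : Type w} [AddCommGroup B] [Module ℂ B]

/-- `A` is a right `K`-comodule `*`-algebra: a unital `*`-algebra with a right coaction
`A → A ⊗ K` which is a unital `*`-homomorphism. -/
structure IsComoduleStarAlgebra (D : ComoduleStarAlgebraData K A) : Prop where
  mul_assoc : ∀ a b c, D.mul (D.mul (a ⊗ₜ b) ⊗ₜ c) = D.mul (a ⊗ₜ D.mul (b ⊗ₜ c))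
  one_mul : ∀ a, D.mul (D.one ⊗ₜ a) = a
  mul_one : ∀ a, D.mul (a ⊗ₜ D.one) = a
  star_star : ∀ a, D.star (D.star a) = a
  star_mul : ∀ a b, D.star (D.mul (a ⊗ₜ b)) = D.mul (D.star b ⊗ₜ D.star a)
  comodule : IsRightComodule (Coalgebra.comul (R := ℂ) (A := K)) Coalgebra.counit D.coact
  coact_mul : ∀ a b, D.coact (D.mul (a ⊗ₜ b)) =
    D.mul.rTensor K (tensorCoact D.coact D.coact (a ⊗ₜ b))
  coact_one : D.coact D.one = D.one ⊗ₜ 1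
  coact_star : ∀ a, D.coact (D.star a) =
    TensorProduct.map D.star (starLinearEquiv ℂ (A := K)).toLinearMap (D.coact a)

/-- `K` as a comodule `*`-algebra over itself, with the coproduct as the coaction. -/
def selfData (K : Type v) [Ring K] [HopfAlgebra ℂ K] [StarRing K] [StarModule ℂ K] :
    ComoduleStarAlgebraData K K where
  mul := LinearMap.mul' ℂ K
  one := 1
  star := (starLinearEquiv ℂ (A := K)).toLinearMap
  coact := Coalgebra.comul

/-- The braided tensor product `A ⊗_R B`, with the product
`(a ⊗ b)(a' ⊗ b') = R(b⁽²⁾, a'⁽²⁾) a a'⁽¹⁾ ⊗ b⁽¹⁾ b'`, the involution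
`(a ⊗ b)^* = (1 ⊗ b^*)(a^* ⊗ 1)`, that is, the braiding of `b^* ⊗ a^*`, and the tensor product
coaction. -/
def braidedTensor (R : K →ₗ[ℂ] K →ₗ[ℂ] ℂ) (D : ComoduleStarAlgebraData K A)
    (E : ComoduleStarAlgebraData K B) : ComoduleStarAlgebraData K (A ⊗[ℂ] B) where
  mul :=
    TensorProduct.map D.mul E.mul ∘ₗ
      (TensorProduct.assoc ℂ A A (B ⊗[ℂ] B)).symm.toLinearMap ∘ₗ
      ((TensorProduct.assoc ℂ A B B).toLinearMap ∘ₗ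
        (braiding R E.coact D.coact).rTensor B ∘ₗ
        (TensorProduct.assoc ℂ B A B).symm.toLinearMap).lTensor A ∘ₗ
      (TensorProduct.assoc ℂ A B (A ⊗[ℂ] B)).toLinearMap
  one := D.one ⊗ₜ E.one
  star := braiding R E.coact D.coact ∘ₛₗ TensorProduct.map E.star D.star ∘ₛₗ
    (TensorProduct.comm ℂ A B).toLinearMap
  coact := tensorCoact D.coact E.coact

/-- The smash product `K # A = K ⊗_R A`, the underlying `*`-algebra of the bosonization. -/
def smash (R : K →ₗ[ℂ] K →ₗ[ℂ] ℂ) (D : ComoduleStarAlgebraData K A) :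
    ComoduleStarAlgebraData K (K ⊗[ℂ] A) :=
  braidedTensor R (selfData K) D

/-- The matrix `W` is unitary over the `*`-algebra given by `D`: `W^* W = 1 = W W^*`. -/
def IsUnitaryOver (D : ComoduleStarAlgebraData K A) {m : ℕ} (W : Matrix (Fin m) (Fin m) A) :
    Prop :=
  (∀ i j, ∑ k, D.mul (D.star (W k i) ⊗ₜ W k j) = if i = j then D.one else 0) ∧
  (∀ i j, ∑ k, D.mul (W i k ⊗ₜ D.star (W j k)) = if i = j then D.one else 0)

/-- The elements `u_{ij}` generate the unital `*`-algebra given by `D`. -/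
def GeneratesStarAlgebra (D : ComoduleStarAlgebraData K A) {m : ℕ}
    (U : Matrix (Fin m) (Fin m) A) : Prop :=
  ∀ S : Submodule ℂ A, D.one ∈ S → (∀ i j, U i j ∈ S) →
    (∀ a ∈ S, ∀ b ∈ S, D.mul (a ⊗ₜ b) ∈ S) → (∀ a ∈ S, D.star a ∈ S) → S = ⊤

end ComoduleStarAlgebra

/-! ### Braided Hopf `*`-algebras -/

/-- The operations of a braided Hopf `*`-algebra on the vector space `A`
(the laws are in `IsBraidedHopfStarAlgebra`). -/
structure BraidedHopfStarData (K : Type v) [Ring K] [HopfAlgebra ℂ K]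
    (A : Type u) [AddCommGroup A] [Module ℂ A] extends ComoduleStarAlgebraData K A where
  comul : A →ₗ[ℂ] A ⊗[ℂ] A
  counit : A →ₗ[ℂ] ℂ
  antipode : A →ₗ[ℂ] A

section BraidedHopf

variable {K : Type v} [Ring K] [HopfAlgebra ℂ K] [StarRing K] [StarModule ℂ K]
  {A : Type u} [AddCommGroup A] [Module ℂ A]

/-- `A` is an object of `Hopf^*(K, R)`: a Hopf `*`-algebra in the category of right `K`-comodules
with the braiding defined by the unitary coquasitriangular structure `R`. -/
structure IsBraidedHopfStarAlgebra (R : K →ₗ[ℂ] K →ₗ[ℂ] ℂ) (D : BraidedHopfStarData K A) :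
    Prop where
  coquasitriangular : IsUnitaryCoquasitriangular R
  comoduleStarAlgebra : IsComoduleStarAlgebra D.toComoduleStarAlgebraData
  /-- coassociativity and the counit identities -/
  coassoc : ∀ a, TensorProduct.assoc ℂ A A A (D.comul.rTensor A (D.comul a)) =
    D.comul.lTensor A (D.comul a)
  counit_left : ∀ a, TensorProduct.lid ℂ A (D.counit.rTensor A (D.comul a)) = a
  counit_right : ∀ a, TensorProduct.rid ℂ A (D.counit.lTensor A (D.comul a)) = a
  /-- the coproduct, the counit and the antipode are maps of `K`-comodules -/
  comul_colinear : ∀ a, tensorCoact D.coact D.coact (D.comul a) =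
    D.comul.rTensor K (D.coact a)
  counit_colinear : ∀ a, TensorProduct.lid ℂ K (D.counit.rTensor K (D.coact a)) = D.counit a • 1
  antipode_colinear : ∀ a, D.coact (D.antipode a) = D.antipode.rTensor K (D.coact a)
  /-- the coproduct is a unital `*`-homomorphism `A → A ⊗_R A` -/
  comul_mul : ∀ a b, D.comul (D.mul (a ⊗ₜ b)) =
    (braidedTensor R D.toComoduleStarAlgebraData D.toComoduleStarAlgebraData).mul
      (D.comul a ⊗ₜ D.comul b)
  comul_one : D.comul D.one = D.one ⊗ₜ D.one
  comul_star : ∀ a, D.comul (D.star a) =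
    (braidedTensor R D.toComoduleStarAlgebraData D.toComoduleStarAlgebraData).star (D.comul a)
  /-- the counit is a unital `*`-homomorphism -/
  counit_mul : ∀ a b, D.counit (D.mul (a ⊗ₜ b)) = D.counit a * D.counit b
  counit_one : D.counit D.one = 1
  counit_star : ∀ a, D.counit (D.star a) = star (D.counit a)
  /-- the antipode identities -/
  antipode_left : ∀ a, D.mul (D.antipode.rTensor A (D.comul a)) = D.counit a • D.one
  antipode_right : ∀ a, D.mul (D.antipode.lTensor A (D.comul a)) = D.counit a • D.one

/-- The map `δ_U(e_j) = ∑_i e_i ⊗ u_{ij}` on the vector space `ℂ^m`. -/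
def matrixCoact {V : Type*} [AddCommGroup V] [Module ℂ V] {m : ℕ}
    (U : Matrix (Fin m) (Fin m) V) : (Fin m → ℂ) →ₗ[ℂ] (Fin m → ℂ) ⊗[ℂ] V :=
  (Pi.basisFun ℂ (Fin m)).constr ℂ fun j => ∑ i, Pi.single i (1 : ℂ) ⊗ₜ[ℂ] U i j

/-- `(Z, U)` defines an `A`-comodule: `δ_Z` is a `K`-comodule, `δ_U` is a comodule for the coalgebra
`A`, and `δ_U` is a map of `K`-comodules. -/
structure DefinesComodule (D : BraidedHopfStarData K A) {m : ℕ}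
    (Z : Matrix (Fin m) (Fin m) K) (U : Matrix (Fin m) (Fin m) A) : Prop where
  base : IsRightComodule (Coalgebra.comul (R := ℂ) (A := K)) Coalgebra.counit (matrixCoact Z)
  comodule : IsRightComodule D.comul D.counit (matrixCoact U)
  colinear : ∀ x, (matrixCoact U).rTensor K (matrixCoact Z x) =
    tensorCoact (matrixCoact Z) D.coact (matrixCoact U x)

/-- The matrix `Z # U` with entries `∑_k z_{ik} # u_{kj}`: the matrix of the `(K # A)`-comodule
`(δ_Z ⊗ ι) δ_U` that corresponds to the `A`-comodule `(Z, U)`. -/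
def smashMatrix {m : ℕ} (Z : Matrix (Fin m) (Fin m) K) (U : Matrix (Fin m) (Fin m) A) :
    Matrix (Fin m) (Fin m) (K ⊗[ℂ] A) :=
  fun i j => ∑ k, Z i k ⊗ₜ[ℂ] U k j

/-- `(Z, U)` defines a unitary `A`-comodule with respect to the standard scalar product on `ℂ^m`:
the corresponding `(K # A)`-comodule is unitary. -/
structure DefinesUnitaryComodule (R : K →ₗ[ℂ] K →ₗ[ℂ] ℂ) (D : BraidedHopfStarData K A) {m : ℕ}
    (Z : Matrix (Fin m) (Fin m) K) (U : Matrix (Fin m) (Fin m) A) : Prop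
    extends DefinesComodule D Z U where
  unitary : IsUnitaryOver (smash R D.toComoduleStarAlgebraData) (smashMatrix Z U)

/-- `(Z, U)` defines a unitarizable `A`-comodule: it becomes unitary in another basis. -/
structure DefinesUnitarizableComodule (R : K →ₗ[ℂ] K →ₗ[ℂ] ℂ) (D : BraidedHopfStarData K A) {m : ℕ}
    (Z : Matrix (Fin m) (Fin m) K) (U : Matrix (Fin m) (Fin m) A) : Prop
    extends DefinesComodule D Z U where
  unitarizable : ∃ F : GL (Fin m) ℂ, DefinesUnitaryComodule R D (scalarConj F Z) (scalarConj F U)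

/-- The matrix `Ū_Z` with entries `∑_{s,l,t} R(z_{tj}^* z_{sl}, z_{il}^*) u_{st}^*`. -/
def conjMatrix (R : K →ₗ[ℂ] K →ₗ[ℂ] ℂ) (D : ComoduleStarAlgebraData K A) {m : ℕ}
    (Z : Matrix (Fin m) (Fin m) K) (U : Matrix (Fin m) (Fin m) A) : Matrix (Fin m) (Fin m) A :=
  fun i j => ∑ s, ∑ l, ∑ t, R (star (Z t j) * Z s l) (star (Z i l)) • D.star (U s t)

end BraidedHopf

/-- The braided Hopf `*`-algebra `A` is a braided compact matrix quantum group over `(T, Z, β)` with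
fundamental unitary `U`. -/
structure IsBraidedCompactMatrixQuantumGroup {T : Type v} [CommGroup T] [TopologicalSpace T]
    {A : Type u} [AddCommGroup A] [Module ℂ A] {m : ℕ}
    (Z : Matrix (Fin m) (Fin m) (FunctionAlgebra T))
    (β : PontryaginDual T →* PontryaginDual T →* Circle)
    (D : BraidedHopfStarData (FunctionAlgebra T) A) (U : Matrix (Fin m) (Fin m) A) : Prop where
  base_unitary : IsUnitaryCorepMatrix Z
  braidedHopf : IsBraidedHopfStarAlgebra (bicharForm β) D
  generates : GeneratesStarAlgebra D.toComoduleStarAlgebraData U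
  unitary : DefinesUnitaryComodule (bicharForm β) D Z U
  conj_unitarizable : DefinesUnitarizableComodule (bicharForm β) D (Z.map star)
    (conjMatrix (bicharForm β) D.toComoduleStarAlgebraData Z U)

/-! ### Transmutation -/

section Transmutation

variable {H : Type u} [Ring H] [HopfAlgebra ℂ H]

/-- The adjoint coaction `x ↦ x₍₂₎ ⊗ S(x₍₁₎) x₍₃₎`. -/
def adjointCoact (H : Type u) [Ring H] [HopfAlgebra ℂ H] : H →ₗ[ℂ] H ⊗[ℂ] H :=
  (LinearMap.mul' ℂ H ∘ₗ (HopfAlgebra.antipode ℂ (A := H)).rTensor H).lTensor H ∘ₗ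
    (TensorProduct.leftComm ℂ H H H).toLinearMap ∘ₗ
    (Coalgebra.comul (R := ℂ) (A := H)).lTensor H ∘ₗ Coalgebra.comul

variable {Γ : Type v} [CommGroup Γ] (π : H →ₐc[ℂ] MonoidAlgebra ℂ Γ)

/-- The subspace `H_{a,b}` of all `x` with
`π(x₍₁₎) ⊗ x₍₂₎ = a ⊗ x` and `x₍₁₎ ⊗ π(x₍₂₎) = x ⊗ b`. -/
def IsHomogeneous (a b : Γ) (x : H) : Prop :=
  (π : H →ₗ[ℂ] MonoidAlgebra ℂ Γ).rTensor H (Coalgebra.comul x) =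
      MonoidAlgebra.single a 1 ⊗ₜ[ℂ] x ∧
    (π : H →ₗ[ℂ] MonoidAlgebra ℂ Γ).lTensor H (Coalgebra.comul x) =
      x ⊗ₜ[ℂ] MonoidAlgebra.single b 1

/-- The linear map `x ↦ f(π(x₍₁₎), π(x₍₃₎)) x₍₂₎`, that is, multiplication by `f(a, b)`
on `H_{a,b}`. -/
def weightMap (f : Γ → Γ → ℂ) : H →ₗ[ℂ] H :=
  (TensorProduct.rid ℂ H).toLinearMap ∘ₗ
    (TensorProduct.lift (bilinExtend f) ∘ₗ
      TensorProduct.map (π : H →ₗ[ℂ] MonoidAlgebra ℂ Γ) (π : H →ₗ[ℂ] MonoidAlgebra ℂ Γ)).lTensor H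
      ∘ₗ (TensorProduct.leftComm ℂ H H H).toLinearMap ∘ₗ
    (Coalgebra.comul (R := ℂ) (A := H)).lTensor H ∘ₗ Coalgebra.comul

variable (β : Γ →* Γ →* Circle)

/-- The coaction `ad_π = (ι ⊗ π) ad`. -/
def transCoact : H →ₗ[ℂ] H ⊗[ℂ] MonoidAlgebra ℂ Γ :=
  (π : H →ₗ[ℂ] MonoidAlgebra ℂ Γ).lTensor H ∘ₗ adjointCoact H

/-- The transmuted product, `x ·_β y = β(x⁽²⁾, S(π(y₍₁₎))) x⁽¹⁾ y₍₂₎` with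
`x⁽¹⁾ ⊗ x⁽²⁾ = ad_π(x)`; on `H_{a,b} × H_{c,d}` this is `β(a⁻¹b, c⁻¹) x y`. -/
def transMul : H ⊗[ℂ] H →ₗ[ℂ] H :=
  (TensorProduct.rid ℂ H).toLinearMap ∘ₗ
    TensorProduct.map (LinearMap.mul' ℂ H) (TensorProduct.lift (bicharForm β)) ∘ₗ
    (TensorProduct.tensorTensorTensorComm ℂ H (MonoidAlgebra ℂ Γ) H (MonoidAlgebra ℂ Γ)).toLinearMap
      ∘ₗ
    TensorProduct.map (transCoact π)
      ((TensorProduct.comm ℂ (MonoidAlgebra ℂ Γ) H).toLinearMap ∘ₗ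
        (HopfAlgebra.antipode ℂ (A := MonoidAlgebra ℂ Γ) ∘ₗ
          (π : H →ₗ[ℂ] MonoidAlgebra ℂ Γ)).rTensor H ∘ₗ
        Coalgebra.comul)

/-- The transmuted antipode: `S_β(x) = β(a⁻¹b, b) S(x)` for `x ∈ H_{a,b}`. -/
def transAntipode : H →ₗ[ℂ] H :=
  HopfAlgebra.antipode ℂ (A := H) ∘ₗ weightMap π fun a b => (β (a⁻¹ * b) b : ℂ)

/-- The transmuted involution: `x^{*_β} = β(a⁻¹b, a⁻¹) x^*` for `x ∈ H_{a,b}`. -/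
def transStar [StarRing H] [StarModule ℂ H] : H →ₗ⋆[ℂ] H :=
  (starLinearEquiv ℂ (A := H)).toLinearMap ∘ₛₗ
    weightMap π fun a b => star (β (a⁻¹ * b) a⁻¹ : ℂ)

/-- The transmutation `H_β` of `H` with respect to `π : H → ℂ[Γ]`: the unit, the coproduct and the
counit are those of `H`. -/
def transmutation [StarRing H] [StarModule ℂ H] : BraidedHopfStarData (MonoidAlgebra ℂ Γ) H where
  mul := transMul π β
  one := 1
  star := transStar π β
  coact := transCoact π
  comul := Coalgebra.comul
  counit := Coalgebra.counit
  antipode := transAntipode π β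

end Transmutation

end BraidedQG

end

noncomputable section

namespace BraidedQG

open TensorProduct

universe u v w

/-! ### The group algebra on its basis of group-like elements -/

section GroupAlgebraLemmas

variable {Γ : Type v}

/-! Pulling back along `π` on both sides grades `ℂ[G]` by `Γ × Γ`, where `Γ` is the dual of `T`. The
bigrading is respected by all the structure. If `x` and `y` have bidegrees `(a, b)` and `(c, d)`,
then `x * y` has bidegree `(ac, bd)`, `S(x)` has `(b⁻¹, a⁻¹)` and `star x` has `(a⁻¹, b⁻¹)`. The
coproduct of `x` lies in the span of the spaces `H_{a,e} ⊗ H_{e,b}` (`comul_mem_comulSpan`), and the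
counit of `x` vanishes unless `a = b`. On homogeneous elements the transmuted operations are the old
ones times values of `β`, and the adjoint coaction has degree `a⁻¹b`. By `homogeneous_induction`,
each axiom of a braided Hopf `*`-algebra thus reduces to the same axiom for `ℂ[G]` and an identity
between values of a bicharacter. Where `Δ(x)` enters, the point is that the resulting scalar does
not depend on the intermediate degree `e`.

Unitarity rests on the observation that `x ↦ π(x₍₁₎) # x₍₂₎` is multiplicative and `*`-preserving
from the original algebra `ℂ[G]` to the smash product with the transmutation (`smash_mul_leftCoact`,
`smash_star_leftCoact`): the scalars of the braiding cancel those of the transmutation. This map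
sends a corepresentation matrix `V` entrywise to `π(V) # V`, so every unitary corepresentation
matrix of `G` gives a unitary braided comodule.

The conjugate matrix `Ū_Z` is the entrywise adjoint of `U` in the original `ℂ[G]`
(`IsUnitaryCorepMatrix.conjMatrix_eq`). Its unitarizability therefore follows by applying the
previous observation to the unitary matrix `F Ū F⁻¹`. Generation survives because the homogeneous
components of the `u_{ij}` are linear combinations of the `u_{kl}`, and on homogeneous elements the
two products and the two involutions differ by nonzero scalars. -/

theorem comul_single_one (a : Γ) :
    Coalgebra.comul (R := ℂ) (MonoidAlgebra.single a (1 : ℂ)) =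
      MonoidAlgebra.single a 1 ⊗ₜ[ℂ] MonoidAlgebra.single a 1 := by
  simp

theorem counit_single_one (a : Γ) :
    Coalgebra.counit (R := ℂ) (MonoidAlgebra.single a (1 : ℂ)) = 1 := by
  simp

theorem antipode_single_one [CommGroup Γ] (a : Γ) :
    HopfAlgebra.antipode ℂ (MonoidAlgebra.single a (1 : ℂ)) = MonoidAlgebra.single a⁻¹ 1 := by
  simp

/-- Induction on the basis of the group algebra. -/
@[elab_as_elim]
theorem groupAlgebra_induction [Group Γ] {p : MonoidAlgebra ℂ Γ → Prop} (x : MonoidAlgebra ℂ Γ)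
    (add : ∀ x y, p x → p y → p (x + y)) (smul : ∀ (c : ℂ) x, p x → p (c • x))
    (single : ∀ a : Γ, p (MonoidAlgebra.single a 1)) : p x := by
  induction x using MonoidAlgebra.induction_linear with
  | zero => simpa using smul 0 _ (single 1)
  | add x y hx hy => exact add x y hx hy
  | single g r => simpa using smul r _ (single g)

theorem bicharForm_single [CommGroup Γ] (β : Γ →* Γ →* Circle) (a b : Γ) :
    bicharForm β (MonoidAlgebra.single a 1) (MonoidAlgebra.single b 1) = (β a b : ℂ) :=
  bilinExtend_single _ a b

/-- The coefficient functional of the basis element `a` of the group algebra. -/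
def coeffAt (a : Γ) : MonoidAlgebra ℂ Γ →ₗ[ℂ] ℂ := (MonoidAlgebra.basis Γ ℂ).coord a

open Classical in
theorem coeffAt_single (a b : Γ) :
    coeffAt a (MonoidAlgebra.single b 1) = if a = b then 1 else 0 := by
  rw [coeffAt, ← MonoidAlgebra.basis_apply, Module.Basis.coord_apply, Module.Basis.repr_self,
    Finsupp.single_apply]
  simp [eq_comm]

theorem coeffAt_single_self (a : Γ) : coeffAt a (MonoidAlgebra.single a 1) = 1 := by
  simp [coeffAt_single]

theorem coeffAt_single_of_ne {a b : Γ} (h : a ≠ b) :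
    coeffAt a (MonoidAlgebra.single b 1) = 0 := by
  simp [coeffAt_single, h]

end GroupAlgebraLemmas

/-! ### The bigrading: projections onto homogeneous components -/

section Homogeneous

variable {H : Type u} [Ring H] [HopfAlgebra ℂ H] {Γ : Type v} [CommGroup Γ]
  (π : H →ₐc[ℂ] MonoidAlgebra ℂ Γ)

/-- The map `x ↦ φ(x₍₁₎) x₍₂₎`. -/
def leftAct (φ : H →ₗ[ℂ] ℂ) : H →ₗ[ℂ] H :=
  (TensorProduct.lid ℂ H).toLinearMap ∘ₗ φ.rTensor H ∘ₗ Coalgebra.comul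

/-- The map `x ↦ φ(x₍₂₎) x₍₁₎`. -/
def rightAct (φ : H →ₗ[ℂ] ℂ) : H →ₗ[ℂ] H :=
  (TensorProduct.rid ℂ H).toLinearMap ∘ₗ φ.lTensor H ∘ₗ Coalgebra.comul

theorem coassoc_symm (x : H) :
    (Coalgebra.comul (R := ℂ)).rTensor H (Coalgebra.comul (R := ℂ) x) =
      (TensorProduct.assoc ℂ H H H).symm
        ((Coalgebra.comul (R := ℂ)).lTensor H (Coalgebra.comul (R := ℂ) x)) := by
  rw [LinearEquiv.eq_symm_apply]; exact Coalgebra.coassoc_apply x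

theorem comul_leftAct (φ : H →ₗ[ℂ] ℂ) (x : H) :
    Coalgebra.comul (R := ℂ) (leftAct φ x) = (leftAct φ).rTensor H (Coalgebra.comul (R := ℂ) x) := by
  simp only [leftAct, LinearMap.rTensor_comp, LinearMap.comp_apply, coassoc_symm]
  generalize Coalgebra.comul (R := ℂ) x = t
  induction t using TensorProduct.induction_on with
  | zero => simp
  | add s t hs ht => simp only [map_add, hs, ht]
  | tmul y z =>
    simp only [LinearMap.rTensor_tmul, LinearMap.lTensor_tmul, LinearEquiv.coe_coe,
      TensorProduct.lid_tmul, map_smul]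
    generalize Coalgebra.comul (R := ℂ) z = t
    induction t using TensorProduct.induction_on with
    | zero => simp
    | add s t hs ht => simp only [map_add, TensorProduct.tmul_add, smul_add, hs, ht]
    | tmul z w => simp [TensorProduct.smul_tmul']

theorem comul_rightAct (φ : H →ₗ[ℂ] ℂ) (x : H) :
    Coalgebra.comul (R := ℂ) (rightAct φ x) =
      (rightAct φ).lTensor H (Coalgebra.comul (R := ℂ) x) := by
  simp only [rightAct, LinearMap.lTensor_comp, LinearMap.comp_apply, ← Coalgebra.coassoc_apply]
  generalize Coalgebra.comul (R := ℂ) x = t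
  induction t using TensorProduct.induction_on with
  | zero => simp
  | add s t hs ht => simp only [map_add, hs, ht]
  | tmul y z =>
    simp only [LinearMap.rTensor_tmul, LinearMap.lTensor_tmul, LinearEquiv.coe_coe,
      TensorProduct.rid_tmul, map_smul]
    generalize Coalgebra.comul (R := ℂ) y = t
    induction t using TensorProduct.induction_on with
    | zero => simp
    | add s t hs ht => simp only [map_add, TensorProduct.add_tmul, smul_add, hs, ht]
    | tmul z w => simp

/-- Both sides are `x₍₁₎ φ(x₍₂₎) ⊗ x₍₃₎`. For a coefficient functional this is what forces the inner
degrees of the two legs of `Δ(x)` to match. -/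
theorem rTensor_rightAct_comul (φ : H →ₗ[ℂ] ℂ) (x : H) :
    (rightAct φ).rTensor H (Coalgebra.comul (R := ℂ) x) =
      (leftAct φ).lTensor H (Coalgebra.comul (R := ℂ) x) := by
  simp only [rightAct, leftAct, LinearMap.rTensor_comp, LinearMap.lTensor_comp,
    LinearMap.comp_apply, coassoc_symm]
  generalize Coalgebra.comul (R := ℂ) x = t
  induction t using TensorProduct.induction_on with
  | zero => simp
  | add s t hs ht => simp only [map_add, hs, ht]
  | tmul y z =>
    simp only [LinearMap.lTensor_tmul]
    generalize Coalgebra.comul (R := ℂ) z = t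
    induction t using TensorProduct.induction_on with
    | zero => simp
    | add s t hs ht => simp only [map_add, TensorProduct.tmul_add, hs, ht]
    | tmul z w => simp [TensorProduct.smul_tmul']

/-- The component of left degree `a`. -/
def leftProj (a : Γ) : H →ₗ[ℂ] H := leftAct (coeffAt a ∘ₗ (π : H →ₗ[ℂ] MonoidAlgebra ℂ Γ))

/-- The component of right degree `b`. -/
def rightProj (b : Γ) : H →ₗ[ℂ] H := rightAct (coeffAt b ∘ₗ (π : H →ₗ[ℂ] MonoidAlgebra ℂ Γ))

end Homogeneous
theorem rTensor_lTensor_apply {M N P Q : Type*} [AddCommGroup M] [Module ℂ M] [AddCommGroup N]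
    [Module ℂ N] [AddCommGroup P] [Module ℂ P] [AddCommGroup Q] [Module ℂ Q]
    (f : M →ₗ[ℂ] N) (g : P →ₗ[ℂ] Q) (t : M ⊗[ℂ] P) :
    f.rTensor Q (g.lTensor M t) = g.lTensor N (f.rTensor P t) := by
  rw [← LinearMap.comp_apply, ← LinearMap.comp_apply, LinearMap.rTensor_comp_lTensor,
    LinearMap.lTensor_comp_rTensor]

section Homogeneous

variable {H : Type u} [Ring H] [HopfAlgebra ℂ H] {Γ : Type v} [CommGroup Γ]
  (π : H →ₐc[ℂ] MonoidAlgebra ℂ Γ)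

theorem lid_coeffAt_comul (a : Γ) (k : MonoidAlgebra ℂ Γ) :
    TensorProduct.lid ℂ _ ((coeffAt a).rTensor _ (Coalgebra.comul (R := ℂ) k)) =
      coeffAt a k • MonoidAlgebra.single a 1 := by
  classical
  induction k using groupAlgebra_induction with
  | add x y hx hy => simp only [map_add, hx, hy, add_smul]
  | smul c x hx => simp only [map_smul, hx, smul_assoc]
  | single b =>
    rw [comul_single_one, LinearMap.rTensor_tmul, TensorProduct.lid_tmul, coeffAt_single]
    split_ifs with h <;> simp [h]

theorem rid_coeffAt_comul (a : Γ) (k : MonoidAlgebra ℂ Γ) :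
    TensorProduct.rid ℂ _ ((coeffAt a).lTensor _ (Coalgebra.comul (R := ℂ) k)) =
      coeffAt a k • MonoidAlgebra.single a 1 := by
  classical
  induction k using groupAlgebra_induction with
  | add x y hx hy => simp only [map_add, hx, hy, add_smul]
  | smul c x hx => simp only [map_smul, hx, smul_assoc]
  | single b =>
    rw [comul_single_one, LinearMap.lTensor_tmul, TensorProduct.rid_tmul, coeffAt_single]
    split_ifs with h <;> simp [h]

theorem map_comul (x : H) : Coalgebra.comul (R := ℂ) (π x) =
    TensorProduct.map (π : H →ₗ[ℂ] MonoidAlgebra ℂ Γ) (π : H →ₗ[ℂ] MonoidAlgebra ℂ Γ)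
      (Coalgebra.comul (R := ℂ) x) :=
  (CoalgHomClass.map_comp_comul_apply π x).symm

theorem map_counit (x : H) : Coalgebra.counit (R := ℂ) (π x) = Coalgebra.counit (R := ℂ) x :=
  CoalgHomClass.counit_comp_apply π x

theorem map_leftProj (a : Γ) (x : H) :
    π (leftProj π a x) = coeffAt a (π x) • MonoidAlgebra.single a 1 := by
  rw [← lid_coeffAt_comul, map_comul]
  simp only [leftProj, leftAct, LinearMap.comp_apply]
  generalize Coalgebra.comul (R := ℂ) x = t
  induction t using TensorProduct.induction_on with
  | zero => simp
  | add s t hs ht => simp only [map_add, hs, ht]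
  | tmul y z => simp

theorem map_rightProj (a : Γ) (x : H) :
    π (rightProj π a x) = coeffAt a (π x) • MonoidAlgebra.single a 1 := by
  rw [← rid_coeffAt_comul, map_comul]
  simp only [rightProj, rightAct, LinearMap.comp_apply]
  generalize Coalgebra.comul (R := ℂ) x = t
  induction t using TensorProduct.induction_on with
  | zero => simp
  | add s t hs ht => simp only [map_add, hs, ht]
  | tmul y z => simp

/-- The left coaction `x ↦ π(x₍₁₎) ⊗ x₍₂₎`. -/
def leftCoact : H →ₗ[ℂ] MonoidAlgebra ℂ Γ ⊗[ℂ] H :=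
  (π : H →ₗ[ℂ] MonoidAlgebra ℂ Γ).rTensor H ∘ₗ Coalgebra.comul

/-- The right coaction `x ↦ x₍₁₎ ⊗ π(x₍₂₎)`. -/
def rightCoact : H →ₗ[ℂ] H ⊗[ℂ] MonoidAlgebra ℂ Γ :=
  (π : H →ₗ[ℂ] MonoidAlgebra ℂ Γ).lTensor H ∘ₗ Coalgebra.comul

theorem isHomogeneous_iff {a b : Γ} {x : H} : IsHomogeneous π a b x ↔
    leftCoact π x = MonoidAlgebra.single a 1 ⊗ₜ x ∧
      rightCoact π x = x ⊗ₜ MonoidAlgebra.single b 1 := Iff.rfl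

theorem leftProj_eq (a : Γ) (x : H) :
    leftProj π a x = TensorProduct.lid ℂ H ((coeffAt a).rTensor H (leftCoact π x)) := by
  simp [leftProj, leftAct, leftCoact, LinearMap.rTensor_comp]

theorem rightProj_eq (a : Γ) (x : H) :
    rightProj π a x = TensorProduct.rid ℂ H ((coeffAt a).lTensor H (rightCoact π x)) := by
  simp [rightProj, rightAct, rightCoact, LinearMap.lTensor_comp]

/-- Coassociativity moves the projection to the first leg of `Δ(x)`, where `π` turns it into a
coefficient times `a`; the coefficient then moves to the second leg and rebuilds the projection
there. -/
theorem leftCoact_leftProj (a : Γ) (x : H) :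
    leftCoact π (leftProj π a x) = MonoidAlgebra.single a 1 ⊗ₜ leftProj π a x := by
  have h : (π : H →ₗ[ℂ] MonoidAlgebra ℂ Γ) ∘ₗ leftProj π a =
      (LinearMap.toSpanSingleton ℂ _ (MonoidAlgebra.single a 1)) ∘ₗ
        (coeffAt a ∘ₗ (π : H →ₗ[ℂ] MonoidAlgebra ℂ Γ)) :=
    LinearMap.ext fun y => map_leftProj π a y
  rw [leftCoact, LinearMap.comp_apply]
  nth_rw 1 [leftProj]
  rw [comul_leftAct, ← leftProj, ← LinearMap.comp_apply, ← LinearMap.rTensor_comp, h, leftProj,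
    leftAct, LinearMap.rTensor_comp]
  simp only [LinearMap.comp_apply]
  generalize Coalgebra.comul (R := ℂ) x = t
  induction t using TensorProduct.induction_on with
  | zero => simp
  | add s t hs ht => simp only [map_add, hs, ht, TensorProduct.tmul_add]
  | tmul y z =>
    simp only [LinearMap.rTensor_tmul, LinearMap.toSpanSingleton_apply, LinearEquiv.coe_coe,
      TensorProduct.lid_tmul, TensorProduct.tmul_smul, TensorProduct.smul_tmul']

theorem rightCoact_rightProj (a : Γ) (x : H) :
    rightCoact π (rightProj π a x) = rightProj π a x ⊗ₜ MonoidAlgebra.single a 1 := by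
  have h : (π : H →ₗ[ℂ] MonoidAlgebra ℂ Γ) ∘ₗ rightProj π a =
      (LinearMap.toSpanSingleton ℂ _ (MonoidAlgebra.single a 1)) ∘ₗ
        (coeffAt a ∘ₗ (π : H →ₗ[ℂ] MonoidAlgebra ℂ Γ)) :=
    LinearMap.ext fun y => map_rightProj π a y
  rw [rightCoact, LinearMap.comp_apply]
  nth_rw 1 [rightProj]
  rw [comul_rightAct, ← rightProj, ← LinearMap.comp_apply, ← LinearMap.lTensor_comp, h, rightProj,
    rightAct, LinearMap.lTensor_comp]
  simp only [LinearMap.comp_apply]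
  generalize Coalgebra.comul (R := ℂ) x = t
  induction t using TensorProduct.induction_on with
  | zero => simp
  | add s t hs ht => simp only [map_add, hs, ht, TensorProduct.add_tmul]
  | tmul y z =>
    simp only [LinearMap.lTensor_tmul, LinearMap.toSpanSingleton_apply, LinearEquiv.coe_coe,
      TensorProduct.rid_tmul, TensorProduct.tmul_smul, TensorProduct.smul_tmul']

theorem leftCoact_rightProj {a : Γ} {x : H} (b : Γ)
    (hx : leftCoact π x = MonoidAlgebra.single a 1 ⊗ₜ x) :
    leftCoact π (rightProj π b x) = MonoidAlgebra.single a 1 ⊗ₜ rightProj π b x := by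
  rw [← LinearMap.lTensor_tmul, ← hx, leftCoact, LinearMap.comp_apply]
  nth_rw 1 [rightProj]
  rw [comul_rightAct, ← rightProj, LinearMap.comp_apply, rTensor_lTensor_apply]

theorem rightCoact_leftProj {b : Γ} {x : H} (a : Γ)
    (hx : rightCoact π x = x ⊗ₜ MonoidAlgebra.single b 1) :
    rightCoact π (leftProj π a x) = leftProj π a x ⊗ₜ MonoidAlgebra.single b 1 := by
  rw [← LinearMap.rTensor_tmul, ← hx, rightCoact, LinearMap.comp_apply]
  nth_rw 1 [leftProj]
  rw [comul_leftAct, ← leftProj, LinearMap.comp_apply, rTensor_lTensor_apply]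

theorem isHomogeneous_leftProj_rightProj (a b : Γ) (x : H) :
    IsHomogeneous π a b (leftProj π a (rightProj π b x)) :=
  ⟨leftCoact_leftProj π a _, rightCoact_leftProj π a (rightCoact_rightProj π b x)⟩

theorem isHomogeneous_rightProj_leftProj (a b : Γ) (x : H) :
    IsHomogeneous π a b (rightProj π b (leftProj π a x)) :=
  ⟨leftCoact_rightProj π b (leftCoact_leftProj π a x), rightCoact_rightProj π b _⟩

theorem leftProj_of_leftCoact {a : Γ} {x : H}
    (hx : leftCoact π x = MonoidAlgebra.single a 1 ⊗ₜ x) : leftProj π a x = x := by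
  simp [leftProj_eq, hx, coeffAt_single_self]

theorem rightProj_of_rightCoact {a : Γ} {x : H}
    (hx : rightCoact π x = x ⊗ₜ MonoidAlgebra.single a 1) : rightProj π a x = x := by
  simp [rightProj_eq, hx, coeffAt_single_self]

/-- Quantifying over all larger finite sets allows the sets belonging to two summands to be merged.
-/
theorem exists_counit_eq_sum_coeffAt (k : MonoidAlgebra ℂ Γ) :
    ∃ F : Finset Γ, ∀ F' : Finset Γ, F ⊆ F' →
      Coalgebra.counit (R := ℂ) k = ∑ a ∈ F', coeffAt a k := by
  classical
  induction k using groupAlgebra_induction with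
  | add x y hx hy =>
    obtain ⟨F, hF⟩ := hx
    obtain ⟨G, hG⟩ := hy
    refine ⟨F ∪ G, fun F' h => ?_⟩
    simp only [map_add, Finset.sum_add_distrib]
    rw [hF F' (Finset.union_subset_left h), hG F' (Finset.union_subset_right h)]
  | smul c x hx =>
    obtain ⟨F, hF⟩ := hx
    refine ⟨F, fun F' h => ?_⟩
    simp only [map_smul, ← Finset.smul_sum]
    rw [hF F' h]
  | single b =>
    refine ⟨{b}, fun F' h => ?_⟩
    have hb : b ∈ F' := h (Finset.mem_singleton_self b)
    simp [coeffAt_single, hb]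

/-- The counit of `H` is the counit of the group algebra after `π`, that is, the sum of the
coefficient functionals. Hence the identity `x = ε(x₍₁₎) x₍₂₎` is itself the decomposition. -/
theorem exists_eq_sum_leftProj (x : H) : ∃ F : Finset Γ, x = ∑ a ∈ F, leftProj π a x := by
  classical
  have key : ∀ t : H ⊗[ℂ] H, ∃ F : Finset Γ, ∀ F' : Finset Γ, F ⊆ F' →
      TensorProduct.lid ℂ H ((Coalgebra.counit (R := ℂ)).rTensor H t) =
        ∑ a ∈ F', TensorProduct.lid ℂ H
          ((coeffAt a ∘ₗ (π : H →ₗ[ℂ] MonoidAlgebra ℂ Γ)).rTensor H t) := by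
    intro t
    induction t using TensorProduct.induction_on with
    | zero => exact ⟨∅, by simp⟩
    | add x y hx hy =>
      obtain ⟨F, hF⟩ := hx
      obtain ⟨G, hG⟩ := hy
      refine ⟨F ∪ G, fun F' h => ?_⟩
      simp only [map_add, Finset.sum_add_distrib]
      rw [hF F' (Finset.union_subset_left h), hG F' (Finset.union_subset_right h)]
    | tmul y z =>
      obtain ⟨F, hF⟩ := exists_counit_eq_sum_coeffAt (π y)
      refine ⟨F, fun F' h => ?_⟩
      have := hF F' h
      rw [map_counit] at this
      simp [this, Finset.sum_smul]
  obtain ⟨F, hF⟩ := key (Coalgebra.comul (R := ℂ) x)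
  refine ⟨F, ?_⟩
  have := hF F subset_rfl
  rw [Coalgebra.rTensor_counit_comul, TensorProduct.lid_tmul, one_smul] at this
  exact this

theorem exists_eq_sum_rightProj (x : H) : ∃ F : Finset Γ, ∀ F' : Finset Γ, F ⊆ F' →
    x = ∑ a ∈ F', rightProj π a x := by
  classical
  have key : ∀ t : H ⊗[ℂ] H, ∃ F : Finset Γ, ∀ F' : Finset Γ, F ⊆ F' →
      TensorProduct.rid ℂ H ((Coalgebra.counit (R := ℂ)).lTensor H t) =
        ∑ a ∈ F', TensorProduct.rid ℂ H
          ((coeffAt a ∘ₗ (π : H →ₗ[ℂ] MonoidAlgebra ℂ Γ)).lTensor H t) := by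
    intro t
    induction t using TensorProduct.induction_on with
    | zero => exact ⟨∅, by simp⟩
    | add x y hx hy =>
      obtain ⟨F, hF⟩ := hx
      obtain ⟨G, hG⟩ := hy
      refine ⟨F ∪ G, fun F' h => ?_⟩
      simp only [map_add, Finset.sum_add_distrib]
      rw [hF F' (Finset.union_subset_left h), hG F' (Finset.union_subset_right h)]
    | tmul y z =>
      obtain ⟨F, hF⟩ := exists_counit_eq_sum_coeffAt (π z)
      refine ⟨F, fun F' h => ?_⟩
      have := hF F' h
      rw [map_counit] at this
      simp [this, Finset.sum_smul]
  obtain ⟨F, hF⟩ := key (Coalgebra.comul (R := ℂ) x)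
  refine ⟨F, fun F' h => ?_⟩
  have := hF F' h
  rw [Coalgebra.lTensor_counit_comul, TensorProduct.rid_tmul, one_smul] at this
  exact this

theorem exists_eq_sum_rTensor_rightProj (t : H ⊗[ℂ] H) : ∃ F : Finset Γ, ∀ F' : Finset Γ, F ⊆ F' →
    t = ∑ e ∈ F', (rightProj π e).rTensor H t := by
  classical
  induction t using TensorProduct.induction_on with
  | zero => exact ⟨∅, by simp⟩
  | add x y hx hy =>
    obtain ⟨F, hF⟩ := hx
    obtain ⟨G, hG⟩ := hy
    refine ⟨F ∪ G, fun F' h => ?_⟩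
    simp only [map_add, Finset.sum_add_distrib]
    rw [← hF F' (Finset.union_subset_left h), ← hG F' (Finset.union_subset_right h)]
  | tmul y z =>
    obtain ⟨F, hF⟩ := exists_eq_sum_rightProj π y
    refine ⟨F, fun F' h => ?_⟩
    simp only [LinearMap.rTensor_tmul, ← TensorProduct.sum_tmul]
    rw [← hF F' h]

theorem exists_eq_sum_leftProj_rightProj (x : H) : ∃ (F : Finset Γ) (G : Γ → Finset Γ),
    x = ∑ b ∈ F, ∑ a ∈ G b, leftProj π a (rightProj π b x) := by
  obtain ⟨F, hF⟩ := exists_eq_sum_rightProj π x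
  choose G hG using fun b => exists_eq_sum_leftProj π (rightProj π b x)
  refine ⟨F, G, ?_⟩
  simp only [← hG]
  exact hF F subset_rfl

/-- No clause for scalars is needed, since the homogeneous components already include all multiples.
-/
theorem homogeneous_induction {p : H → Prop} (x : H)
    (add : ∀ x y, p x → p y → p (x + y))
    (homogeneous : ∀ a b x, IsHomogeneous π a b x → p x) : p x := by
  -- Zero is homogeneous of every bidegree; it covers empty sums.
  have zero : p 0 := homogeneous 1 1 0 ⟨by simp, by simp⟩
  obtain ⟨F, G, h⟩ := exists_eq_sum_leftProj_rightProj π x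
  rw [h]
  exact Finset.sum_induction _ _ add zero fun b _ => Finset.sum_induction _ _ add zero
    fun a _ => homogeneous a b _ (isHomogeneous_leftProj_rightProj π a b x)

/-- The span in `H ⊗ H` of the spaces `H_{a,e} ⊗ H_{e,b}`. -/
def comulSpan (a b : Γ) : Submodule ℂ (H ⊗[ℂ] H) :=
  Submodule.span ℂ {t | ∃ e y z, IsHomogeneous π a e y ∧ IsHomogeneous π e b z ∧ y ⊗ₜ z = t}

/-- The outer degrees are inherited from `x`, because the outer projections commute with the
coproduct. Splitting the first leg by its right degree `e` fixes the left degree of the second leg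
to be `e` as well. -/
theorem comul_mem_comulSpan {a b : Γ} {x : H} (hx : IsHomogeneous π a b x) :
    Coalgebra.comul (R := ℂ) x ∈ comulSpan π a b := by
  have h1 : Coalgebra.comul (R := ℂ) x =
      (leftProj π a).rTensor H ((rightProj π b).lTensor H (Coalgebra.comul (R := ℂ) x)) := by
    rw [rightProj, ← comul_rightAct, leftProj, ← comul_leftAct, ← rightProj, ← leftProj,
      rightProj_of_rightCoact π hx.2, leftProj_of_leftCoact π hx.1]
  obtain ⟨F, hF⟩ := exists_eq_sum_rTensor_rightProj π (Coalgebra.comul (R := ℂ) x)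
  rw [hF F subset_rfl]
  refine Submodule.sum_mem _ fun e _ => ?_
  -- The projection `rightProj π e` is idempotent, so one copy of it can be kept on the first leg
  -- while the other is transferred to the second.
  have h2 : (rightProj π e).rTensor H (Coalgebra.comul (R := ℂ) x) =
      (rightProj π e).rTensor H ((leftProj π e).lTensor H (Coalgebra.comul (R := ℂ) x)) := by
    rw [leftProj, ← rTensor_rightAct_comul, ← rightProj, ← LinearMap.rTensor_comp_apply]
    congr 2
    ext y
    exact (rightProj_of_rightCoact π (rightCoact_rightProj π e y)).symm
  rw [h2, h1]
  generalize Coalgebra.comul (R := ℂ) x = t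
  induction t using TensorProduct.induction_on with
  | zero => simp
  | add s t hs ht => simpa only [map_add] using add_mem hs ht
  | tmul y z =>
    exact Submodule.subset_span ⟨e, _, _, isHomogeneous_rightProj_leftProj π a e y,
      isHomogeneous_leftProj_rightProj π e b z, rfl⟩

end Homogeneous
-- The bigrading and the Hopf `*`-structure
section Homogeneous

variable {H : Type u} [Ring H] [HopfAlgebra ℂ H] {Γ : Type v} [CommGroup Γ]
  (π : H →ₐc[ℂ] MonoidAlgebra ℂ Γ)

open WithConv in
/-- A left convolution inverse of an algebra map `h` is `h ∘ S`. -/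
theorem eq_comp_antipode {A : Type*} [Ring A] [Algebra ℂ A] (h : H →ₐ[ℂ] A) (g : H →ₗ[ℂ] A)
    (hg : ∀ x, LinearMap.mul' ℂ A (TensorProduct.map g h.toLinearMap (Coalgebra.comul (R := ℂ) x)) =
      algebraMap ℂ A (Coalgebra.counit (R := ℂ) x)) (x : H) :
    g x = h (HopfAlgebra.antipode ℂ x) := by
  have h1 : toConv g * toConv h.toLinearMap = 1 := by
    ext x; exact hg x
  have h2 : toConv h.toLinearMap * toConv (h.toLinearMap ∘ₗ HopfAlgebra.antipode ℂ (A := H)) = 1 := by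
    have := LinearMap.algHom_comp_convMul_distrib (R := ℂ) h (toConv LinearMap.id)
      (toConv (HopfAlgebra.antipode ℂ (A := H)))
    rw [LinearMap.id_mul_antipode] at this
    apply WithConv.ofConv_injective
    rw [ofConv_toConv, ofConv_toConv, LinearMap.comp_id] at this
    rw [← this]
    ext x
    simp [LinearMap.convOne_def]
  exact congr($(left_inv_eq_right_inv h1 h2) x)

/-- `S ∘ π` is a left convolution inverse of `π`, and such an inverse must be `π ∘ S`. -/
theorem map_antipode (x : H) :
    π (HopfAlgebra.antipode ℂ x) = HopfAlgebra.antipode ℂ (π x) := by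
  symm
  refine eq_comp_antipode (π : H →ₐ[ℂ] MonoidAlgebra ℂ Γ)
    (HopfAlgebra.antipode ℂ ∘ₗ (π : H →ₗ[ℂ] MonoidAlgebra ℂ Γ)) (fun x => ?_) x
  rw [← map_counit π, ← HopfAlgebra.mul_antipode_rTensor_comul_apply, map_comul]
  generalize Coalgebra.comul (R := ℂ) x = t
  induction t using TensorProduct.induction_on with
  | zero => simp
  | add s t hs ht => simp only [map_add, hs, ht]
  | tmul y z => simp

/-- The left coaction as an algebra map. -/
def leftCoactHom : H →ₐ[ℂ] MonoidAlgebra ℂ Γ ⊗[ℂ] H :=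
  (Algebra.TensorProduct.map (π : H →ₐ[ℂ] MonoidAlgebra ℂ Γ) (AlgHom.id ℂ H)).comp
    (Bialgebra.comulAlgHom ℂ H)

/-- The right coaction as an algebra map. -/
def rightCoactHom : H →ₐ[ℂ] H ⊗[ℂ] MonoidAlgebra ℂ Γ :=
  (Algebra.TensorProduct.map (AlgHom.id ℂ H) (π : H →ₐ[ℂ] MonoidAlgebra ℂ Γ)).comp
    (Bialgebra.comulAlgHom ℂ H)

theorem leftCoactHom_apply (x : H) : leftCoactHom π x = leftCoact π x := rfl

theorem rightCoactHom_apply (x : H) : rightCoactHom π x = rightCoact π x := rfl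

theorem leftCoact_mul (x y : H) : leftCoact π (x * y) = leftCoact π x * leftCoact π y :=
  map_mul (leftCoactHom π) x y

theorem rightCoact_mul (x y : H) : rightCoact π (x * y) = rightCoact π x * rightCoact π y :=
  map_mul (rightCoactHom π) x y

variable {π} {a b c d : Γ} {x y : H}

theorem IsHomogeneous.left (hx : IsHomogeneous π a b x) :
    leftCoact π x = MonoidAlgebra.single a 1 ⊗ₜ x := hx.1

theorem IsHomogeneous.right (hx : IsHomogeneous π a b x) :
    rightCoact π x = x ⊗ₜ MonoidAlgebra.single b 1 := hx.2

theorem isHomogeneous_one : IsHomogeneous π 1 1 (1 : H) :=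
  ⟨map_one (leftCoactHom π), map_one (rightCoactHom π)⟩

theorem IsHomogeneous.mul (hx : IsHomogeneous π a b x) (hy : IsHomogeneous π c d y) :
    IsHomogeneous π (a * c) (b * d) (x * y) := by
  rw [isHomogeneous_iff, leftCoact_mul, rightCoact_mul, hx.left, hx.right, hy.left, hy.right]
  simp [Algebra.TensorProduct.tmul_mul_tmul, MonoidAlgebra.single_mul_single]

theorem IsHomogeneous.map_eq_left (hx : IsHomogeneous π a b x) :
    π x = Coalgebra.counit (R := ℂ) x • MonoidAlgebra.single a 1 := by
  have h := congrArg (TensorProduct.rid ℂ _ ∘ (Coalgebra.counit (R := ℂ)).lTensor _) hx.left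
  simp only [Function.comp_apply, leftCoact, LinearMap.comp_apply, LinearMap.lTensor_tmul,
    TensorProduct.rid_tmul] at h
  rw [← rTensor_lTensor_apply, Coalgebra.lTensor_counit_comul] at h
  simpa using h

theorem IsHomogeneous.map_eq_right (hx : IsHomogeneous π a b x) :
    π x = Coalgebra.counit (R := ℂ) x • MonoidAlgebra.single b 1 := by
  have h := congrArg (TensorProduct.lid ℂ _ ∘ (Coalgebra.counit (R := ℂ)).rTensor _) hx.right
  simp only [Function.comp_apply, rightCoact, LinearMap.comp_apply, LinearMap.rTensor_tmul,
    TensorProduct.lid_tmul] at h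
  rw [rTensor_lTensor_apply, Coalgebra.rTensor_counit_comul] at h
  simpa using h

/-- Computing `π(x)` from either coaction gives `ε(x) a = ε(x) b`, and distinct group elements are
linearly independent. -/
theorem IsHomogeneous.counit_eq_zero (hx : IsHomogeneous π a b x) (hab : a ≠ b) :
    Coalgebra.counit (R := ℂ) x = 0 := by
  have h := congrArg (coeffAt a) (hx.map_eq_left.symm.trans hx.map_eq_right)
  rwa [map_smul, map_smul, coeffAt_single_self, coeffAt_single_of_ne hab, smul_zero, smul_eq_mul,
    mul_one] at h

/-- Anticomultiplicativity of the antipode is not invoked: uniqueness of the convolution inverse of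
the coaction, an algebra map, identifies its composite with `S`. -/
theorem leftCoact_antipode (hx : IsHomogeneous π a b x) :
    leftCoact π (HopfAlgebra.antipode ℂ x) =
      MonoidAlgebra.single b⁻¹ 1 ⊗ₜ HopfAlgebra.antipode ℂ x := by
  -- The candidate inverse is `x ↦ S(π(x₍₂₎)) ⊗ S(x₍₁₎)`. On `H_{a,e} ⊗ H_{e,b}` the factors `e⁻¹`
  -- and `e` cancel and leave `1 ⊗ S(y) z`.
  set g : H →ₗ[ℂ] MonoidAlgebra ℂ Γ ⊗[ℂ] H :=
    TensorProduct.map (HopfAlgebra.antipode ℂ) (HopfAlgebra.antipode ℂ) ∘ₗ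
      (TensorProduct.comm ℂ H (MonoidAlgebra ℂ Γ)).toLinearMap ∘ₗ rightCoact π with hg
  have hgh : ∀ {a b : Γ} {x : H}, IsHomogeneous π a b x →
      g x = MonoidAlgebra.single b⁻¹ 1 ⊗ₜ HopfAlgebra.antipode ℂ x := by
    intro a b x hx
    simp [hg, hx.right]
  rw [← hgh hx, ← leftCoactHom_apply]
  symm
  refine eq_comp_antipode (leftCoactHom π) g (fun x => ?_) x
  induction x using homogeneous_induction π with
  | add x y hx hy => simp only [map_add, hx, hy]
  | homogeneous a b x hx =>
    have key : ∀ t ∈ comulSpan π a b,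
        LinearMap.mul' ℂ _ (TensorProduct.map g (leftCoactHom π).toLinearMap t) =
          (1 : MonoidAlgebra ℂ Γ) ⊗ₜ
            LinearMap.mul' ℂ H ((HopfAlgebra.antipode ℂ).rTensor H t) := by
      intro t ht
      induction ht using Submodule.span_induction with
      | zero => simp
      | add s t _ _ hs ht => simp only [map_add, hs, ht, TensorProduct.tmul_add]
      | smul r t _ ht => simp only [map_smul, ht, TensorProduct.tmul_smul]
      | mem t ht =>
        obtain ⟨e, y, z, hy, hz, rfl⟩ := ht
        simp [hgh hy, leftCoactHom_apply, hz.left, MonoidAlgebra.one_def]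
    rw [key _ (comul_mem_comulSpan π hx), HopfAlgebra.mul_antipode_rTensor_comul_apply,
      Algebra.algebraMap_eq_smul_one, Algebra.algebraMap_eq_smul_one, TensorProduct.tmul_smul,
      Algebra.TensorProduct.one_def]

theorem rightCoact_antipode (hx : IsHomogeneous π a b x) :
    rightCoact π (HopfAlgebra.antipode ℂ x) =
      HopfAlgebra.antipode ℂ x ⊗ₜ MonoidAlgebra.single a⁻¹ 1 := by
  set g : H →ₗ[ℂ] H ⊗[ℂ] MonoidAlgebra ℂ Γ :=
    TensorProduct.map (HopfAlgebra.antipode ℂ) (HopfAlgebra.antipode ℂ) ∘ₗ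
      (TensorProduct.comm ℂ (MonoidAlgebra ℂ Γ) H).toLinearMap ∘ₗ leftCoact π with hg
  have hgh : ∀ {a b : Γ} {x : H}, IsHomogeneous π a b x →
      g x = HopfAlgebra.antipode ℂ x ⊗ₜ MonoidAlgebra.single a⁻¹ 1 := by
    intro a b x hx
    simp [hg, hx.left]
  rw [← hgh hx, ← rightCoactHom_apply]
  symm
  refine eq_comp_antipode (rightCoactHom π) g (fun x => ?_) x
  induction x using homogeneous_induction π with
  | add x y hx hy => simp only [map_add, hx, hy]
  | homogeneous a b x hx =>
    have key : ∀ t ∈ comulSpan π a b,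
        LinearMap.mul' ℂ _ (TensorProduct.map g (rightCoactHom π).toLinearMap t) =
          LinearMap.mul' ℂ H ((HopfAlgebra.antipode ℂ).rTensor H t) ⊗ₜ
            MonoidAlgebra.single (a⁻¹ * b) 1 := by
      intro t ht
      induction ht using Submodule.span_induction with
      | zero => simp
      | add s t _ _ hs ht => simp only [map_add, hs, ht, TensorProduct.add_tmul]
      | smul r t _ ht => simp only [map_smul, ht, TensorProduct.smul_tmul']
      | mem t ht =>
        obtain ⟨e, y, z, hy, hz, rfl⟩ := ht
        simp [hgh hy, rightCoactHom_apply, hz.right]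
    rw [key _ (comul_mem_comulSpan π hx), HopfAlgebra.mul_antipode_rTensor_comul_apply]
    -- On this side the group factor `a⁻¹b` survives; it is trivial when `a = b`, and otherwise the
    -- counit vanishes.
    by_cases hab : a = b
    · subst hab
      rw [inv_mul_cancel, ← MonoidAlgebra.one_def, Algebra.algebraMap_eq_smul_one,
        Algebra.algebraMap_eq_smul_one, ← TensorProduct.smul_tmul', Algebra.TensorProduct.one_def]
    · simp [hx.counit_eq_zero hab]

theorem IsHomogeneous.antipode (hx : IsHomogeneous π a b x) :
    IsHomogeneous π b⁻¹ a⁻¹ (HopfAlgebra.antipode ℂ x) :=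
  ⟨leftCoact_antipode hx, rightCoact_antipode hx⟩

section Star

variable [StarRing H] [StarModule ℂ H]

theorem leftCoact_star (hH : IsHopfStar H) (hπ : ∀ x, π (star x) = star (π x)) (x : H) :
    leftCoact π (star x) = star (leftCoact π x) := by
  rw [leftCoact, LinearMap.comp_apply, LinearMap.comp_apply, hH]
  generalize Coalgebra.comul (R := ℂ) x = t
  induction t using TensorProduct.induction_on with
  | zero => simp
  | add s t hs ht => simp only [map_add, star_add, hs, ht]
  | tmul y z => simp [TensorProduct.star_tmul, hπ]

theorem rightCoact_star (hH : IsHopfStar H) (hπ : ∀ x, π (star x) = star (π x)) (x : H) :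
    rightCoact π (star x) = star (rightCoact π x) := by
  rw [rightCoact, LinearMap.comp_apply, LinearMap.comp_apply, hH]
  generalize Coalgebra.comul (R := ℂ) x = t
  induction t using TensorProduct.induction_on with
  | zero => simp
  | add s t hs ht => simp only [map_add, star_add, hs, ht]
  | tmul y z => simp [TensorProduct.star_tmul, hπ]

theorem IsHomogeneous.star (hH : IsHopfStar H) (hπ : ∀ x, π (star x) = star (π x))
    (hx : IsHomogeneous π a b x) : IsHomogeneous π a⁻¹ b⁻¹ (star x) := by
  rw [isHomogeneous_iff, leftCoact_star hH hπ, rightCoact_star hH hπ, hx.left, hx.right]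
  simp [TensorProduct.star_tmul, star_single]

end Star

/-! ### The transmuted operations on homogeneous elements -/

variable (π)

/-- The map `x ↦ x₍₂₎ ⊗ π(x₍₁₎) ⊗ π(x₍₃₎)`. -/
def biCoact : H →ₗ[ℂ] H ⊗[ℂ] (MonoidAlgebra ℂ Γ ⊗[ℂ] MonoidAlgebra ℂ Γ) :=
  (TensorProduct.leftComm ℂ (MonoidAlgebra ℂ Γ) H (MonoidAlgebra ℂ Γ)).toLinearMap ∘ₗ
    (rightCoact π).lTensor _ ∘ₗ leftCoact π

/-- Links the triple coproduct used in the definitions of the adjoint coaction and of `weightMap` to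
two successive coactions, for which homogeneous elements are eigenvectors. -/
theorem biCoact_eq (x : H) :
    (TensorProduct.map (π : H →ₗ[ℂ] MonoidAlgebra ℂ Γ)
      (π : H →ₗ[ℂ] MonoidAlgebra ℂ Γ)).lTensor H
        (TensorProduct.leftComm ℂ H H H ((Coalgebra.comul (R := ℂ) (A := H)).lTensor H
          (Coalgebra.comul (R := ℂ) x))) = biCoact π x := by
  simp only [biCoact, leftCoact, LinearMap.comp_apply]
  generalize Coalgebra.comul (R := ℂ) x = t
  induction t using TensorProduct.induction_on with
  | zero => simp
  | add s t hs ht => simp only [map_add, hs, ht]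
  | tmul y z =>
    simp only [LinearMap.lTensor_tmul, LinearMap.rTensor_tmul, rightCoact, LinearMap.comp_apply]
    generalize Coalgebra.comul (R := ℂ) z = t
    induction t using TensorProduct.induction_on with
    | zero => simp
    | add s t hs ht => simp only [map_add, TensorProduct.tmul_add, hs, ht]
    | tmul z w => simp

theorem transCoact_eq (x : H) : transCoact π x =
    (LinearMap.mul' ℂ _ ∘ₗ (HopfAlgebra.antipode ℂ (A := MonoidAlgebra ℂ Γ)).rTensor _).lTensor H
      (biCoact π x) := by
  rw [← biCoact_eq]
  simp only [transCoact, adjointCoact, LinearMap.comp_apply, LinearEquiv.coe_coe]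
  generalize TensorProduct.leftComm ℂ H H H _ = t
  rw [← LinearMap.lTensor_comp_apply, ← LinearMap.lTensor_comp_apply]
  congr 2
  ext y z
  simp [map_antipode]

theorem weightMap_eq (f : Γ → Γ → ℂ) (x : H) : weightMap π f x =
    TensorProduct.rid ℂ H ((TensorProduct.lift (bilinExtend f)).lTensor H (biCoact π x)) := by
  rw [← biCoact_eq]
  simp only [weightMap, LinearMap.comp_apply, LinearEquiv.coe_coe, LinearMap.lTensor_comp]

variable {π}

theorem IsHomogeneous.biCoact (hx : IsHomogeneous π a b x) :
    biCoact π x = x ⊗ₜ (MonoidAlgebra.single a 1 ⊗ₜ MonoidAlgebra.single b 1) := by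
  simp [BraidedQG.biCoact, hx.left, hx.right]

theorem IsHomogeneous.transCoact (hx : IsHomogeneous π a b x) :
    transCoact π x = x ⊗ₜ MonoidAlgebra.single (a⁻¹ * b) 1 := by
  simp [transCoact_eq, hx.biCoact]

theorem IsHomogeneous.weightMap (f : Γ → Γ → ℂ) (hx : IsHomogeneous π a b x) :
    weightMap π f x = f a b • x := by
  simp [weightMap_eq, hx.biCoact, bilinExtend_single]

theorem IsHomogeneous.transAntipode (β : Γ →* Γ →* Circle) (hx : IsHomogeneous π a b x) :
    transAntipode π β x = (β (a⁻¹ * b) b : ℂ) • HopfAlgebra.antipode ℂ x := by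
  rw [BraidedQG.transAntipode, LinearMap.comp_apply, hx.weightMap, map_smul]

/-- The weight in the definition is conjugated, and the conjugate-linearity of the involution undoes
this. -/
theorem IsHomogeneous.transStar [StarRing H] [StarModule ℂ H] (β : Γ →* Γ →* Circle)
    (hx : IsHomogeneous π a b x) :
    transStar π β x = (β (a⁻¹ * b) a⁻¹ : ℂ) • Star.star x := by
  rw [BraidedQG.transStar, LinearMap.comp_apply, hx.weightMap]
  simp

theorem IsHomogeneous.transMul (β : Γ →* Γ →* Circle) (hx : IsHomogeneous π a b x)
    (hy : IsHomogeneous π c d y) :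
    transMul π β (x ⊗ₜ y) = (β (a⁻¹ * b) c⁻¹ : ℂ) • (x * y) := by
  have h : (HopfAlgebra.antipode ℂ (A := MonoidAlgebra ℂ Γ) ∘ₗ
      (π : H →ₗ[ℂ] MonoidAlgebra ℂ Γ)).rTensor H (Coalgebra.comul (R := ℂ) y) =
        MonoidAlgebra.single c⁻¹ 1 ⊗ₜ y := by
    have := hy.left
    rw [leftCoact, LinearMap.comp_apply] at this
    rw [LinearMap.rTensor_comp_apply, this]
    simp
  simp only [BraidedQG.transMul, LinearMap.comp_apply, TensorProduct.map_tmul, hx.transCoact, h,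
    LinearEquiv.coe_coe, TensorProduct.comm_tmul, TensorProduct.tensorTensorTensorComm_tmul,
    TensorProduct.lift.tmul, bicharForm_single, TensorProduct.rid_tmul, LinearMap.mul'_apply]

end Homogeneous
-- A bicharacter as a unitary coquasitriangular structure
section Coquasitriangular

variable {Γ : Type v} [CommGroup Γ] (β : Γ →* Γ →* Circle)

theorem star_bichar (a b : Γ) : (starRingEnd ℂ) (β a b : ℂ) = ((β a b)⁻¹ : Circle) :=
  (Circle.coe_inv_eq_conj _).symm

theorem conjForm_single (a b : Γ) :
    conjForm (bicharForm β) (MonoidAlgebra.single a 1 ⊗ₜ MonoidAlgebra.single b 1) =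
      ((β a b)⁻¹ : Circle) := by
  simp only [conjForm, LinearMap.comp_apply, LinearEquiv.coe_coe, starLinearEquiv_apply,
    TensorProduct.star_tmul, star_single, star_one, TensorProduct.lift.tmul, bicharForm_single]
  have h : β a⁻¹ b⁻¹ = β a b := by simp
  rw [h]
  exact star_bichar β a b

theorem comul₂_single (a b : Γ) :
    comul₂ (MonoidAlgebra ℂ Γ) (MonoidAlgebra.single a 1 ⊗ₜ MonoidAlgebra.single b 1) =
      (MonoidAlgebra.single a 1 ⊗ₜ MonoidAlgebra.single b 1) ⊗ₜ
        (MonoidAlgebra.single a 1 ⊗ₜ MonoidAlgebra.single b 1) := by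
  simp only [comul₂, LinearMap.comp_apply, TensorProduct.map_tmul, comul_single_one,
    LinearEquiv.coe_coe, TensorProduct.tensorTensorTensorComm_tmul]

/-- Two linear maps on `ℂ[Γ] ⊗ ℂ[Γ]` that agree on the basis agree. -/
theorem eq_of_single_tmul_single {M : Type*} [AddCommGroup M] [Module ℂ M]
    (f g : MonoidAlgebra ℂ Γ ⊗[ℂ] MonoidAlgebra ℂ Γ →ₗ[ℂ] M)
    (h : ∀ a b, f (MonoidAlgebra.single a 1 ⊗ₜ MonoidAlgebra.single b 1) =
      g (MonoidAlgebra.single a 1 ⊗ₜ MonoidAlgebra.single b 1)) : f = g := by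
  refine TensorProduct.ext' fun x y => ?_
  induction x using groupAlgebra_induction with
  | add x x' hx hx' => simp only [TensorProduct.add_tmul, map_add, hx, hx']
  | smul c x hx => simp only [← TensorProduct.smul_tmul', map_smul, hx]
  | single a =>
    induction y using groupAlgebra_induction with
    | add x x' hx hx' => simp only [TensorProduct.tmul_add, map_add, hx, hx']
    | smul c x hx => simp only [TensorProduct.tmul_smul, map_smul, hx]
    | single b => exact h a b

/-- All identities are linear in each variable, and on group-like elements they become
bimultiplicativity, commutativity of `Γ` and `|β| = 1`. -/
theorem isUnitaryCoquasitriangular_bicharForm : IsUnitaryCoquasitriangular (bicharForm β) where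
  mul_left x y z := by
    induction z using groupAlgebra_induction with
    | add z z' hz hz' => simp only [map_add, hz, hz']
    | smul c z hz => simp only [map_smul, hz]
    | single z =>
      induction x using groupAlgebra_induction with
      | add x x' hx hx' =>
        simp only [add_mul, map_add, LinearMap.add_apply, TensorProduct.map_add_left, hx, hx']
      | smul c x hx =>
        simp only [smul_mul_assoc, map_smul, LinearMap.smul_apply, TensorProduct.map_smul_left, hx]
      | single x =>
        induction y using groupAlgebra_induction with
        | add x x' hx hx' =>
          simp only [mul_add, map_add, LinearMap.add_apply, TensorProduct.map_add_right, hx, hx']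
        | smul c x hx =>
          simp only [mul_smul_comm, map_smul, LinearMap.smul_apply, TensorProduct.map_smul_right,
            hx]
        | single y =>
          rw [comul_single_one, MonoidAlgebra.single_mul_single, mul_one]
          simp [bicharForm_single]
  mul_right x y z := by
    induction x using groupAlgebra_induction with
    | add z z' hz hz' => simp only [map_add, LinearMap.add_apply, hz, hz']
    | smul c z hz => simp only [map_smul, LinearMap.smul_apply, hz]
    | single x =>
      induction z using groupAlgebra_induction with
      | add x x' hx hx' =>
        simp only [mul_add, map_add, LinearMap.add_apply, TensorProduct.map_add_left, hx, hx']
      | smul c x hx =>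
        simp only [mul_smul_comm, map_smul, LinearMap.smul_apply, TensorProduct.map_smul_left, hx]
      | single z =>
        induction y using groupAlgebra_induction with
        | add x x' hx hx' =>
          simp only [add_mul, map_add, LinearMap.add_apply, TensorProduct.map_add_right, hx, hx']
        | smul c x hx =>
          simp only [smul_mul_assoc, map_smul, LinearMap.smul_apply, TensorProduct.map_smul_right,
            hx]
        | single y =>
          rw [comul_single_one, MonoidAlgebra.single_mul_single, mul_one]
          simp [bicharForm_single, mul_comm]
  comm x y := by
    have h := eq_of_single_tmul_single
      ((TensorProduct.rid ℂ (MonoidAlgebra ℂ Γ)).toLinearMap ∘ₗ TensorProduct.map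
        (LinearMap.mul' ℂ (MonoidAlgebra ℂ Γ) ∘ₗ
          (TensorProduct.comm ℂ (MonoidAlgebra ℂ Γ) (MonoidAlgebra ℂ Γ)).toLinearMap)
          (TensorProduct.lift (bicharForm β)) ∘ₗ comul₂ (MonoidAlgebra ℂ Γ))
      ((TensorProduct.lid ℂ (MonoidAlgebra ℂ Γ)).toLinearMap ∘ₗ TensorProduct.map
        (TensorProduct.lift (bicharForm β)) (LinearMap.mul' ℂ (MonoidAlgebra ℂ Γ)) ∘ₗ
          comul₂ (MonoidAlgebra ℂ Γ))
      fun a b => by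
        simp only [LinearMap.comp_apply, comul₂_single, TensorProduct.map_tmul,
          TensorProduct.lift.tmul, bicharForm_single, LinearEquiv.coe_coe, TensorProduct.comm_tmul,
          TensorProduct.rid_tmul, TensorProduct.lid_tmul, LinearMap.mul'_apply]
        rw [mul_comm]
    exact LinearMap.congr_fun h (x ⊗ₜ y)
  conv_conj x y := by
    have h := eq_of_single_tmul_single
      (LinearMap.mul' ℂ ℂ ∘ₗ TensorProduct.map (TensorProduct.lift (bicharForm β))
        (conjForm (bicharForm β)) ∘ₗ comul₂ (MonoidAlgebra ℂ Γ))
      (LinearMap.mul' ℂ ℂ ∘ₗ TensorProduct.map (Coalgebra.counit (A := MonoidAlgebra ℂ Γ))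
        (Coalgebra.counit (A := MonoidAlgebra ℂ Γ)))
      fun a b => by
        simp only [LinearMap.comp_apply, comul₂_single, TensorProduct.map_tmul,
          TensorProduct.lift.tmul, bicharForm_single, conjForm_single, LinearMap.mul'_apply,
          counit_single_one]
        simp
    exact LinearMap.congr_fun h (x ⊗ₜ y)
  conj_conv x y := by
    have h := eq_of_single_tmul_single
      (LinearMap.mul' ℂ ℂ ∘ₗ TensorProduct.map (conjForm (bicharForm β))
        (TensorProduct.lift (bicharForm β)) ∘ₗ comul₂ (MonoidAlgebra ℂ Γ))
      (LinearMap.mul' ℂ ℂ ∘ₗ TensorProduct.map (Coalgebra.counit (A := MonoidAlgebra ℂ Γ))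
        (Coalgebra.counit (A := MonoidAlgebra ℂ Γ)))
      fun a b => by
        simp only [LinearMap.comp_apply, comul₂_single, TensorProduct.map_tmul,
          TensorProduct.lift.tmul, bicharForm_single, conjForm_single, LinearMap.mul'_apply,
          counit_single_one]
        simp
    exact LinearMap.congr_fun h (x ⊗ₜ y)

end Coquasitriangular

/-! ### Braided tensor products on elements of pure degree -/

section Braided

variable {Γ : Type v} [CommGroup Γ] (β : Γ →* Γ →* Circle)

section

variable {M N : Type*} [AddCommGroup M] [Module ℂ M] [AddCommGroup N] [Module ℂ N]
  {δM : M →ₗ[ℂ] M ⊗[ℂ] MonoidAlgebra ℂ Γ} {δN : N →ₗ[ℂ] N ⊗[ℂ] MonoidAlgebra ℂ Γ}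
  {x : M} {y : N} {p q : Γ}

theorem tensorCoact_of_degree (hx : δM x = x ⊗ₜ MonoidAlgebra.single p 1)
    (hy : δN y = y ⊗ₜ MonoidAlgebra.single q 1) :
    tensorCoact δM δN (x ⊗ₜ y) = (x ⊗ₜ y) ⊗ₜ MonoidAlgebra.single (p * q) 1 := by
  simp [tensorCoact, hx, hy, MonoidAlgebra.single_mul_single]

theorem braiding_of_degree (hx : δM x = x ⊗ₜ MonoidAlgebra.single p 1)
    (hy : δN y = y ⊗ₜ MonoidAlgebra.single q 1) :
    braiding (bicharForm β) δM δN (x ⊗ₜ y) = (β p q : ℂ) • (y ⊗ₜ x) := by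
  simp [braiding, hx, hy, bicharForm_single]

end

variable {A B : Type*} [AddCommGroup A] [Module ℂ A] [AddCommGroup B] [Module ℂ B]
  {D : ComoduleStarAlgebraData (MonoidAlgebra ℂ Γ) A}
  {E : ComoduleStarAlgebraData (MonoidAlgebra ℂ Γ) B}

theorem braidedTensor_mul_of_degree {x x' : A} {y y' : B} {p q : Γ}
    (hy : E.coact y = y ⊗ₜ MonoidAlgebra.single p 1)
    (hx : D.coact x' = x' ⊗ₜ MonoidAlgebra.single q 1) :
    (braidedTensor (bicharForm β) D E).mul ((x ⊗ₜ y) ⊗ₜ (x' ⊗ₜ y')) =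
      (β p q : ℂ) • (D.mul (x ⊗ₜ x') ⊗ₜ E.mul (y ⊗ₜ y')) := by
  simp only [braidedTensor, LinearMap.comp_apply, LinearEquiv.coe_coe, TensorProduct.assoc_tmul,
    LinearMap.lTensor_tmul, TensorProduct.assoc_symm_tmul, LinearMap.rTensor_tmul,
    braiding_of_degree β hy hx, ← TensorProduct.smul_tmul', map_smul, TensorProduct.tmul_smul,
    TensorProduct.map_tmul]

theorem braidedTensor_star_of_degree {x : A} {y : B} {p q : Γ}
    (hy : E.coact (E.star y) = E.star y ⊗ₜ MonoidAlgebra.single p 1)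
    (hx : D.coact (D.star x) = D.star x ⊗ₜ MonoidAlgebra.single q 1) :
    (braidedTensor (bicharForm β) D E).star (x ⊗ₜ y) =
      (β p q : ℂ) • (D.star x ⊗ₜ E.star y) := by
  simp only [braidedTensor, LinearMap.comp_apply, LinearEquiv.coe_coe, TensorProduct.comm_tmul,
    TensorProduct.map_tmul, braiding_of_degree β hy hx]

end Braided

/-! ### The transmutation is a braided Hopf `*`-algebra -/

section Transmutation

variable {H : Type u} [Ring H] [HopfAlgebra ℂ H] {Γ : Type v} [CommGroup Γ]
  (π : H →ₐc[ℂ] MonoidAlgebra ℂ Γ) (β : Γ →* Γ →* Circle)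

theorem transCoact_isRightComodule :
    IsRightComodule (Coalgebra.comul (R := ℂ) (A := MonoidAlgebra ℂ Γ)) Coalgebra.counit
      (transCoact π) where
  coassoc x := by
    induction x using homogeneous_induction π with
    | add x y hx hy => simp only [map_add, hx, hy]
    | homogeneous a b x hx =>
      rw [hx.transCoact, LinearMap.rTensor_tmul, hx.transCoact, LinearMap.lTensor_tmul,
        comul_single_one, TensorProduct.assoc_tmul]
  counit x := by
    induction x using homogeneous_induction π with
    | add x y hx hy => simp only [map_add, hx, hy]
    | homogeneous a b x hx =>
      rw [hx.transCoact, LinearMap.lTensor_tmul, counit_single_one, TensorProduct.rid_tmul,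
        one_smul]

/-- The scalar `β(a⁻¹b, c⁻¹)` is a bicharacter of the two bidegrees, hence a 2-cocycle. -/
theorem transMul_assoc (x y z : H) : transMul π β (transMul π β (x ⊗ₜ y) ⊗ₜ z) =
    transMul π β (x ⊗ₜ transMul π β (y ⊗ₜ z)) := by
  induction x using homogeneous_induction π with
  | add x x' hx hx' => simp only [TensorProduct.add_tmul, map_add, hx, hx']
  | homogeneous a b x hx =>
  induction y using homogeneous_induction π with
  | add x x' hx hx' => simp only [TensorProduct.add_tmul, TensorProduct.tmul_add, map_add, hx, hx']
  | homogeneous c d y hy =>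
  induction z using homogeneous_induction π with
  | add x x' hx hx' => simp only [TensorProduct.tmul_add, map_add, hx, hx']
  | homogeneous e f z hz =>
  simp only [hx.transMul β hy, hy.transMul β hz, ← TensorProduct.smul_tmul',
    TensorProduct.tmul_smul, map_smul, (hx.mul hy).transMul β hz, hx.transMul β (hy.mul hz),
    smul_smul, mul_assoc]
  congr 1
  simp only [map_mul, map_inv, mul_inv_rev, MonoidHom.mul_apply, MonoidHom.inv_apply,
    Circle.coe_mul, Circle.coe_inv]
  field_simp

theorem one_transMul (x : H) : transMul π β (1 ⊗ₜ x) = x := by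
  induction x using homogeneous_induction π with
  | add x x' hx hx' => simp only [TensorProduct.tmul_add, map_add, hx, hx']
  | homogeneous a b x hx => simp [isHomogeneous_one.transMul β hx]

theorem transMul_one (x : H) : transMul π β (x ⊗ₜ 1) = x := by
  induction x using homogeneous_induction π with
  | add x x' hx hx' => simp only [TensorProduct.add_tmul, map_add, hx, hx']
  | homogeneous a b x hx => simp [hx.transMul β isHomogeneous_one]

theorem transCoact_transMul (x y : H) : transCoact π (transMul π β (x ⊗ₜ y)) =
    (transMul π β).rTensor _ (tensorCoact (transCoact π) (transCoact π) (x ⊗ₜ y)) := by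
  induction x using homogeneous_induction π with
  | add x x' hx hx' => simp only [TensorProduct.add_tmul, map_add, hx, hx']
  | homogeneous a b x hx =>
  induction y using homogeneous_induction π with
  | add x x' hx hx' => simp only [TensorProduct.tmul_add, map_add, hx, hx']
  | homogeneous c d y hy =>
  rw [tensorCoact_of_degree hx.transCoact hy.transCoact, LinearMap.rTensor_tmul, hx.transMul β hy,
    map_smul, (hx.mul hy).transCoact, TensorProduct.smul_tmul']
  congr 2
  rw [mul_inv, mul_mul_mul_comm]

theorem transCoact_one : transCoact π (1 : H) = 1 ⊗ₜ 1 := by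
  simp [isHomogeneous_one.transCoact, MonoidAlgebra.one_def]

section Star

variable [StarRing H] [StarModule ℂ H]

theorem transStar_transStar (hH : IsHopfStar H) (hπ : ∀ x, π (star x) = star (π x)) (x : H) :
    transStar π β (transStar π β x) = x := by
  induction x using homogeneous_induction π with
  | add x x' hx hx' => simp only [map_add, hx, hx']
  | homogeneous a b x hx =>
  rw [hx.transStar, LinearMap.map_smulₛₗ, (hx.star hH hπ).transStar, star_star, smul_smul,
    star_bichar]
  conv_rhs => rw [← one_smul ℂ x]
  congr 1
  simp only [map_mul, map_inv, mul_inv_rev, MonoidHom.mul_apply, MonoidHom.inv_apply,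
    Circle.coe_mul, Circle.coe_inv, inv_inv]
  field_simp

theorem transStar_transMul (hH : IsHopfStar H) (hπ : ∀ x, π (star x) = star (π x)) (x y : H) :
    transStar π β (transMul π β (x ⊗ₜ y)) =
      transMul π β (transStar π β y ⊗ₜ transStar π β x) := by
  induction x using homogeneous_induction π with
  | add x x' hx hx' => simp only [TensorProduct.add_tmul, TensorProduct.tmul_add, map_add, hx, hx']
  | homogeneous a b x hx =>
  induction y using homogeneous_induction π with
  | add x x' hx hx' => simp only [TensorProduct.add_tmul, TensorProduct.tmul_add, map_add, hx, hx']
  | homogeneous c d y hy =>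
  rw [hx.transMul β hy, LinearMap.map_smulₛₗ, (hx.mul hy).transStar, hx.transStar, hy.transStar,
    TensorProduct.tmul_smul, ← TensorProduct.smul_tmul', map_smul, map_smul,
    (hy.star hH hπ).transMul β (hx.star hH hπ), smul_smul, smul_smul, smul_smul, star_mul,
    star_bichar]
  congr 1
  simp only [map_mul, map_inv, mul_inv_rev, MonoidHom.mul_apply, MonoidHom.inv_apply,
    Circle.coe_mul, Circle.coe_inv, inv_inv]
  field_simp

theorem transCoact_transStar (hH : IsHopfStar H) (hπ : ∀ x, π (star x) = star (π x)) (x : H) :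
    transCoact π (transStar π β x) = TensorProduct.map (transStar π β)
      (starLinearEquiv ℂ (A := MonoidAlgebra ℂ Γ)).toLinearMap (transCoact π x) := by
  induction x using homogeneous_induction π with
  | add x x' hx hx' => simp only [map_add, hx, hx']
  | homogeneous a b x hx =>
  rw [hx.transStar, map_smul, (hx.star hH hπ).transCoact, hx.transCoact, TensorProduct.map_tmul,
    hx.transStar, TensorProduct.smul_tmul']
  congr 1
  simp [star_single, mul_comm]

theorem transmutation_isComoduleStarAlgebra (hH : IsHopfStar H)
    (hπ : ∀ x, π (star x) = star (π x)) :
    IsComoduleStarAlgebra (transmutation π β).toComoduleStarAlgebraData where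
  mul_assoc := transMul_assoc π β
  one_mul := one_transMul π β
  mul_one := transMul_one π β
  star_star := transStar_transStar π β hH hπ
  star_mul := transStar_transMul π β hH hπ
  comodule := transCoact_isRightComodule π
  coact_mul := transCoact_transMul π β
  coact_one := transCoact_one π
  coact_star := transCoact_transStar π β hH hπ

end Star

theorem tensorCoact_of_mem_comulSpan {a b : Γ} {t : H ⊗[ℂ] H} (ht : t ∈ comulSpan π a b) :
    tensorCoact (transCoact π) (transCoact π) t = t ⊗ₜ MonoidAlgebra.single (a⁻¹ * b) 1 := by
  induction ht using Submodule.span_induction with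
  | zero => simp
  | add s t _ _ hs ht => simp only [map_add, hs, ht, TensorProduct.add_tmul]
  | smul r t _ ht => simp only [map_smul, ht, TensorProduct.smul_tmul']
  | mem t ht =>
    obtain ⟨e, y, z, hy, hz, rfl⟩ := ht
    rw [tensorCoact_of_degree hy.transCoact hz.transCoact]
    congr 2
    group

theorem transCoact_comul (x : H) :
    tensorCoact (transCoact π) (transCoact π) (Coalgebra.comul (R := ℂ) x) =
      (Coalgebra.comul (R := ℂ)).rTensor _ (transCoact π x) := by
  induction x using homogeneous_induction π with
  | add x x' hx hx' => simp only [map_add, hx, hx']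
  | homogeneous a b x hx =>
  rw [hx.transCoact, tensorCoact_of_mem_comulSpan π (comul_mem_comulSpan π hx),
    LinearMap.rTensor_tmul]

theorem transCoact_counit (x : H) :
    TensorProduct.lid ℂ _ ((Coalgebra.counit (R := ℂ)).rTensor (MonoidAlgebra ℂ Γ)
      (transCoact π x)) = Coalgebra.counit (R := ℂ) x • 1 := by
  induction x using homogeneous_induction π with
  | add x x' hx hx' => simp only [map_add, add_smul, hx, hx']
  | homogeneous a b x hx =>
  rw [hx.transCoact, LinearMap.rTensor_tmul, TensorProduct.lid_tmul]
  by_cases hab : a = b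
  · simp [hab, MonoidAlgebra.one_def]
  · simp [hx.counit_eq_zero hab]

theorem transCoact_transAntipode (x : H) :
    transCoact π (transAntipode π β x) = (transAntipode π β).rTensor _ (transCoact π x) := by
  induction x using homogeneous_induction π with
  | add x x' hx hx' => simp only [map_add, hx, hx']
  | homogeneous a b x hx =>
  rw [hx.transCoact, hx.transAntipode, map_smul, hx.antipode.transCoact, LinearMap.rTensor_tmul,
    hx.transAntipode, TensorProduct.smul_tmul']
  congr 2
  rw [inv_inv, mul_comm]

theorem counit_transMul (x y : H) : Coalgebra.counit (R := ℂ) (transMul π β (x ⊗ₜ y)) =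
    Coalgebra.counit (R := ℂ) x * Coalgebra.counit (R := ℂ) y := by
  induction x using homogeneous_induction π with
  | add x x' hx hx' => simp only [TensorProduct.add_tmul, map_add, hx, hx', add_mul]
  | homogeneous a b x hx =>
  induction y using homogeneous_induction π with
  | add x x' hx hx' => simp only [TensorProduct.tmul_add, map_add, hx, hx', mul_add]
  | homogeneous c d y hy =>
  rw [hx.transMul β hy, map_smul, Bialgebra.counit_mul]
  by_cases hab : a = b
  · simp [hab]
  · simp [hx.counit_eq_zero hab]

theorem transMul_transAntipode_rTensor (x : H) :
    transMul π β ((transAntipode π β).rTensor H (Coalgebra.comul (R := ℂ) x)) =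
      Coalgebra.counit (R := ℂ) x • 1 := by
  induction x using homogeneous_induction π with
  | add x x' hx hx' => simp only [map_add, hx, hx', add_smul]
  | homogeneous a b x hx =>
  -- On `H_{a,e} ⊗ H_{e,b}` the antipode contributes `β(a⁻¹e, e)` and the product `β(ea⁻¹, e⁻¹)...`
  -- has the same left argument, so that the two cancel.
  have key : ∀ t ∈ comulSpan π a b, transMul π β ((transAntipode π β).rTensor H t) =
      LinearMap.mul' ℂ H ((HopfAlgebra.antipode ℂ).rTensor H t) := by
    intro t ht
    induction ht using Submodule.span_induction with
    | zero => simp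
    | add s t _ _ hs ht => simp only [map_add, hs, ht]
    | smul r t _ ht => simp only [map_smul, ht]
    | mem t ht =>
      obtain ⟨e, y, z, hy, hz, rfl⟩ := ht
      rw [LinearMap.rTensor_tmul, LinearMap.rTensor_tmul, hy.transAntipode,
        ← TensorProduct.smul_tmul', map_smul, hy.antipode.transMul β hz, smul_smul,
        LinearMap.mul'_apply]
      conv_rhs => rw [← one_smul ℂ (_ * _)]
      congr 1
      simp only [map_mul, map_inv, MonoidHom.mul_apply, MonoidHom.inv_apply,
        Circle.coe_mul, Circle.coe_inv, inv_inv]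
      field_simp
  rw [key _ (comul_mem_comulSpan π hx), HopfAlgebra.mul_antipode_rTensor_comul_apply,
    Algebra.algebraMap_eq_smul_one]

theorem transMul_transAntipode_lTensor (x : H) :
    transMul π β ((transAntipode π β).lTensor H (Coalgebra.comul (R := ℂ) x)) =
      Coalgebra.counit (R := ℂ) x • 1 := by
  induction x using homogeneous_induction π with
  | add x x' hx hx' => simp only [map_add, hx, hx', add_smul]
  | homogeneous a b x hx =>
  -- Here the scalars `β(e⁻¹b, b)` and `β(a⁻¹e, b)` multiply to `β(a⁻¹b, b)`, which is free of `e`.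
  -- It equals `1` when `a = b`, the only case in which the counit can be nonzero.
  have key : ∀ t ∈ comulSpan π a b, transMul π β ((transAntipode π β).lTensor H t) =
      (β (a⁻¹ * b) b : ℂ) • LinearMap.mul' ℂ H ((HopfAlgebra.antipode ℂ).lTensor H t) := by
    intro t ht
    induction ht using Submodule.span_induction with
    | zero => simp
    | add s t _ _ hs ht => simp only [map_add, hs, ht, smul_add]
    | smul r t _ ht => simp only [map_smul, ht, smul_comm r]
    | mem t ht =>
      obtain ⟨e, y, z, hy, hz, rfl⟩ := ht
      rw [LinearMap.lTensor_tmul, LinearMap.lTensor_tmul, hz.transAntipode,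
        TensorProduct.tmul_smul, map_smul, hy.transMul β hz.antipode, smul_smul,
        LinearMap.mul'_apply]
      congr 1
      simp only [map_mul, map_inv, MonoidHom.mul_apply, MonoidHom.inv_apply,
        Circle.coe_mul, Circle.coe_inv, inv_inv]
      field_simp
  rw [key _ (comul_mem_comulSpan π hx), HopfAlgebra.mul_antipode_lTensor_comul_apply,
    Algebra.algebraMap_eq_smul_one]
  by_cases hab : a = b
  · simp [hab]
  · simp [hx.counit_eq_zero hab]

variable [StarRing H] [StarModule ℂ H]

theorem comul_transMul (x y : H) : Coalgebra.comul (R := ℂ) (transMul π β (x ⊗ₜ y)) =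
    (braidedTensor (bicharForm β) (transmutation π β).toComoduleStarAlgebraData
      (transmutation π β).toComoduleStarAlgebraData).mul
      (Coalgebra.comul (R := ℂ) x ⊗ₜ Coalgebra.comul (R := ℂ) y) := by
  induction x using homogeneous_induction π with
  | add x x' hx hx' => simp only [TensorProduct.add_tmul, map_add, hx, hx']
  | homogeneous a b x hx =>
  induction y using homogeneous_induction π with
  | add x x' hx hx' => simp only [TensorProduct.tmul_add, map_add, hx, hx']
  | homogeneous c d y hy =>
  -- For inner degrees `e` and `f`, the braiding gives `β(e⁻¹b, c⁻¹f)` and the two products give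
  -- `β(a⁻¹e, c⁻¹) β(e⁻¹b, f⁻¹)`. Both `e` and `f` drop out, leaving the scalar of the product of
  -- `x` and `y`.
  have key : ∀ s ∈ comulSpan π a b, ∀ t ∈ comulSpan π c d,
      (braidedTensor (bicharForm β) (transmutation π β).toComoduleStarAlgebraData
        (transmutation π β).toComoduleStarAlgebraData).mul (s ⊗ₜ t) =
        (β (a⁻¹ * b) c⁻¹ : ℂ) • (s * t) := by
    intro s hs t ht
    induction hs using Submodule.span_induction with
    | zero => simp
    | add s s' _ _ hs hs' => simp only [TensorProduct.add_tmul, map_add, hs, hs', add_mul, smul_add]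
    | smul r s _ hs =>
      simp only [← TensorProduct.smul_tmul', map_smul, hs, smul_mul_assoc, smul_comm r]
    | mem s hs =>
      obtain ⟨e, y, z, hy, hz, rfl⟩ := hs
      induction ht using Submodule.span_induction with
      | zero => simp
      | add s s' _ _ hs hs' =>
        simp only [TensorProduct.tmul_add, map_add, hs, hs', mul_add, smul_add]
      | smul r s _ hs =>
        simp only [TensorProduct.tmul_smul, map_smul, hs, mul_smul_comm, smul_comm r]
      | mem t ht =>
        obtain ⟨f, y', z', hy', hz', rfl⟩ := ht
        rw [braidedTensor_mul_of_degree β hz.transCoact hy'.transCoact]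
        change _ • (transMul π β (y ⊗ₜ y') ⊗ₜ transMul π β (z ⊗ₜ z')) = _
        rw [hy.transMul β hy', hz.transMul β hz', Algebra.TensorProduct.tmul_mul_tmul,
          ← TensorProduct.smul_tmul', TensorProduct.tmul_smul, smul_smul, smul_smul]
        congr 1
        simp only [map_mul, map_inv, MonoidHom.mul_apply, MonoidHom.inv_apply,
          Circle.coe_mul, Circle.coe_inv]
        field_simp
  rw [key _ (comul_mem_comulSpan π hx) _ (comul_mem_comulSpan π hy), hx.transMul β hy, map_smul,
    Bialgebra.comul_mul]

theorem comul_transStar (hH : IsHopfStar H) (hπ : ∀ x, π (star x) = star (π x)) (x : H) :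
    Coalgebra.comul (R := ℂ) (transStar π β x) =
      (braidedTensor (bicharForm β) (transmutation π β).toComoduleStarAlgebraData
        (transmutation π β).toComoduleStarAlgebraData).star (Coalgebra.comul (R := ℂ) x) := by
  induction x using homogeneous_induction π with
  | add x x' hx hx' => simp only [map_add, hx, hx']
  | homogeneous a b x hx =>
  -- The braiding scalar `β(eb⁻¹, ae⁻¹)` combines with `β(a⁻¹e, a⁻¹) β(e⁻¹b, e⁻¹)` from the two
  -- involutions to give `β(a⁻¹b, a⁻¹)`, again free of `e`.
  have key : ∀ t ∈ comulSpan π a b,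
      (braidedTensor (bicharForm β) (transmutation π β).toComoduleStarAlgebraData
        (transmutation π β).toComoduleStarAlgebraData).star t =
        (β (a⁻¹ * b) a⁻¹ : ℂ) • star t := by
    intro t ht
    induction ht using Submodule.span_induction with
    | zero => simp
    | add s s' _ _ hs hs' => simp only [map_add, hs, hs', star_add, smul_add]
    | smul r s _ hs =>
      rw [LinearMap.map_smulₛₗ, hs, star_smul, smul_comm]
      rfl
    | mem t ht =>
      obtain ⟨e, y, z, hy, hz, rfl⟩ := ht
      have hz' : transCoact π (transStar π β z) =
          transStar π β z ⊗ₜ MonoidAlgebra.single (e⁻¹⁻¹ * b⁻¹) 1 := by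
        rw [hz.transStar, map_smul, (hz.star hH hπ).transCoact, TensorProduct.smul_tmul']
      have hy' : transCoact π (transStar π β y) =
          transStar π β y ⊗ₜ MonoidAlgebra.single (a⁻¹⁻¹ * e⁻¹) 1 := by
        rw [hy.transStar, map_smul, (hy.star hH hπ).transCoact, TensorProduct.smul_tmul']
      rw [braidedTensor_star_of_degree β hz' hy']
      change _ • (transStar π β y ⊗ₜ transStar π β z) = _
      rw [hy.transStar, hz.transStar, TensorProduct.star_tmul,
        ← TensorProduct.smul_tmul', TensorProduct.tmul_smul, smul_smul, smul_smul]
      congr 1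
      simp only [map_mul, map_inv, MonoidHom.mul_apply, MonoidHom.inv_apply,
        Circle.coe_mul, Circle.coe_inv, inv_inv]
      field_simp
  rw [key _ (comul_mem_comulSpan π hx), hx.transStar, map_smul, hH]

/-- The counit of a Hopf `*`-algebra is a `*`-map. -/
theorem counit_star_of_isHopfStar (hH : IsHopfStar H) (x : H) :
    Coalgebra.counit (R := ℂ) (star x) = star (Coalgebra.counit (R := ℂ) x) := by
  -- The functional `y ↦ conj(ε(y^*))` also satisfies the left counit identity.
  set e : H →ₗ[ℂ] ℂ := (starLinearEquiv ℂ (A := ℂ)).toLinearMap ∘ₛₗ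
    (Coalgebra.counit (R := ℂ) (A := H)) ∘ₛₗ (starLinearEquiv ℂ (A := H)).toLinearMap with he
  have he' : ∀ y, e y = star (Coalgebra.counit (R := ℂ) (star y)) := fun y => rfl
  have h1 : ∀ y, TensorProduct.lid ℂ H (e.rTensor H (Coalgebra.comul (R := ℂ) y)) = y := by
    intro y
    have h := Coalgebra.rTensor_counit_comul (R := ℂ) (star y)
    rw [hH] at h
    have h2 : ∀ t : H ⊗[ℂ] H, TensorProduct.lid ℂ H (e.rTensor H t) =
        star (TensorProduct.lid ℂ H ((Coalgebra.counit (R := ℂ)).rTensor H (star t))) := by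
      intro t
      induction t using TensorProduct.induction_on with
      | zero => simp
      | add s t hs ht => simp only [map_add, star_add, hs, ht]
      | tmul y z => simp [TensorProduct.star_tmul, he']
    rw [h2, h]
    simp
  -- A left counit equals a right counit: both sides are the value of `e ⊗ ε` on the coproduct.
  have h3 : e (star x) = Coalgebra.counit (R := ℂ) (star x) := by
    have h := congrArg (Coalgebra.counit (R := ℂ)) (h1 (star x))
    rw [← h]
    have h4 := congrArg (fun t => e (TensorProduct.rid ℂ H t))
      (Coalgebra.lTensor_counit_comul (R := ℂ) (star x))
    simp only [TensorProduct.rid_tmul, one_smul] at h4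
    rw [← h4]
    generalize Coalgebra.comul (R := ℂ) (star x) = t
    induction t using TensorProduct.induction_on with
    | zero => simp
    | add s t hs ht => simp only [map_add, hs, ht]
    | tmul y z => simp [mul_comm]
  rw [← h3, he', star_star]

theorem counit_transStar (hH : IsHopfStar H) (x : H) :
    Coalgebra.counit (R := ℂ) (transStar π β x) = star (Coalgebra.counit (R := ℂ) x) := by
  induction x using homogeneous_induction π with
  | add x x' hx hx' => simp only [map_add, hx, hx', star_add]
  | homogeneous a b x hx =>
  rw [hx.transStar, map_smul, counit_star_of_isHopfStar hH]
  by_cases hab : a = b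
  · simp [hab]
  · simp [hx.counit_eq_zero hab]

theorem transmutation_isBraidedHopfStarAlgebra (hH : IsHopfStar H)
    (hπ : ∀ x, π (star x) = star (π x)) :
    IsBraidedHopfStarAlgebra (bicharForm β) (transmutation π β) where
  coquasitriangular := isUnitaryCoquasitriangular_bicharForm β
  comoduleStarAlgebra := transmutation_isComoduleStarAlgebra π β hH hπ
  coassoc := Coalgebra.coassoc_apply
  counit_left a := by
    change TensorProduct.lid ℂ H ((Coalgebra.counit (R := ℂ)).rTensor H
      (Coalgebra.comul (R := ℂ) a)) = a
    simp
  counit_right a := by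
    change TensorProduct.rid ℂ H ((Coalgebra.counit (R := ℂ)).lTensor H
      (Coalgebra.comul (R := ℂ) a)) = a
    simp
  comul_colinear := transCoact_comul π
  counit_colinear := transCoact_counit π
  antipode_colinear := transCoact_transAntipode π β
  comul_mul := comul_transMul π β
  comul_one := Bialgebra.comul_one
  comul_star := comul_transStar π β hH hπ
  counit_mul := counit_transMul π β
  counit_one := Bialgebra.counit_one
  counit_star := counit_transStar π β hH
  antipode_left := transMul_transAntipode_rTensor π β
  antipode_right := transMul_transAntipode_lTensor π β

end Transmutation

/-! ### Corepresentation matrices and their comodules -/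

theorem matrixCoact_single {V : Type*} [AddCommGroup V] [Module ℂ V] {m : ℕ}
    (U : Matrix (Fin m) (Fin m) V) (j : Fin m) :
    matrixCoact U (Pi.single j 1) = ∑ i, Pi.single i (1 : ℂ) ⊗ₜ[ℂ] U i j := by
  rw [matrixCoact, ← Pi.basisFun_apply, Module.Basis.constr_basis]

@[elab_as_elim]
theorem pi_single_induction {m : ℕ} {p : (Fin m → ℂ) → Prop} (x : Fin m → ℂ)
    (zero : p 0) (add : ∀ x y, p x → p y → p (x + y)) (smul : ∀ (c : ℂ) x, p x → p (c • x))
    (single : ∀ j, p (Pi.single j 1)) : p x := by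
  rw [← (Pi.basisFun ℂ (Fin m)).sum_repr x]
  refine Finset.sum_induction _ _ add zero fun j _ => smul _ _ ?_
  rw [Pi.basisFun_apply]
  exact single j

section Corep

variable {H : Type u} [Ring H] [HopfAlgebra ℂ H] {m : ℕ} {U : Matrix (Fin m) (Fin m) H}

theorem IsCorepMatrix.isRightComodule (hU : IsCorepMatrix U) :
    IsRightComodule (Coalgebra.comul (R := ℂ) (A := H)) Coalgebra.counit (matrixCoact U) where
  coassoc x := by
    induction x using pi_single_induction with
    | zero => simp
    | add x y hx hy => simp only [map_add, hx, hy]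
    | smul c x hx => simp only [map_smul, hx]
    | single j =>
      simp only [matrixCoact_single, map_sum, LinearMap.rTensor_tmul, LinearMap.lTensor_tmul,
        hU.comul_eq, TensorProduct.sum_tmul, TensorProduct.tmul_sum, TensorProduct.assoc_tmul]
      exact Finset.sum_comm
  counit x := by
    induction x using pi_single_induction with
    | zero => simp
    | add x y hx hy => simp only [map_add, hx, hy]
    | smul c x hx => simp only [map_smul, hx]
    | single j =>
      simp [matrixCoact_single, LinearMap.lTensor_tmul, hU.counit_eq]

theorem IsCorepMatrix.antipode_mul (hU : IsCorepMatrix U) :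
    U.map (HopfAlgebra.antipode ℂ) * U = 1 := by
  ext i j
  have h := HopfAlgebra.mul_antipode_rTensor_comul_apply (R := ℂ) (U i j)
  rw [hU.comul_eq, hU.counit_eq] at h
  simp only [map_sum, LinearMap.rTensor_tmul, LinearMap.mul'_apply] at h
  rw [Matrix.mul_apply, Matrix.one_apply]
  simp only [Matrix.map_apply, h]
  split_ifs <;> simp

theorem IsCorepMatrix.mul_antipode (hU : IsCorepMatrix U) :
    U * U.map (HopfAlgebra.antipode ℂ) = 1 := by
  ext i j
  have h := HopfAlgebra.mul_antipode_lTensor_comul_apply (R := ℂ) (U i j)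
  rw [hU.comul_eq, hU.counit_eq] at h
  simp only [map_sum, LinearMap.lTensor_tmul, LinearMap.mul'_apply] at h
  rw [Matrix.mul_apply, Matrix.one_apply]
  simp only [Matrix.map_apply, h]
  split_ifs <;> simp

/-- The matrix `S(U)` is a left inverse of `U` and the adjoint `U^*` is a right inverse, so they
coincide. -/
theorem IsUnitaryCorepMatrix.antipode_eq [StarRing H] [StarModule ℂ H]
    (hU : IsUnitaryCorepMatrix U) (i j : Fin m) :
    HopfAlgebra.antipode ℂ (U i j) = star (U j i) := by
  have h := left_inv_eq_right_inv hU.antipode_mul (Unitary.mul_star_self_of_mem hU.mem_unitary)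
  exact congr($h i j)

theorem IsCorepMatrix.map_star [StarRing H] [StarModule ℂ H] (hH : IsHopfStar H)
    (hU : IsCorepMatrix U) : IsCorepMatrix (U.map star) where
  comul_eq i j := by
    simp [hH (U i j), hU.comul_eq, star_sum, TensorProduct.star_tmul]
  counit_eq i j := by
    rw [Matrix.map_apply, counit_star_of_isHopfStar hH, hU.counit_eq]
    split_ifs <;> simp

variable {Γ : Type v} [CommGroup Γ] (π : H →ₐc[ℂ] MonoidAlgebra ℂ Γ)

theorem IsCorepMatrix.map (hU : IsCorepMatrix U) : IsCorepMatrix (U.map π) where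
  comul_eq i j := by
    simp [map_comul, hU.comul_eq]
  counit_eq i j := by
    rw [Matrix.map_apply, map_counit, hU.counit_eq]

theorem IsUnitaryCorepMatrix.map [StarRing H] [StarModule ℂ H]
    (hπ : ∀ x, π (star x) = star (π x)) (hU : IsUnitaryCorepMatrix U) :
    IsUnitaryCorepMatrix (U.map π) where
  toIsCorepMatrix := hU.toIsCorepMatrix.map π
  mem_unitary := by
    have hs : star (U.map π) = (star U).map π := by
      ext i j; simp [Matrix.star_apply, hπ]
    have h1 := Unitary.star_mul_self_of_mem hU.mem_unitary
    have h2 := Unitary.mul_star_self_of_mem hU.mem_unitary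
    have hm : ∀ V W : Matrix (Fin m) (Fin m) H, V.map π * W.map π = (V * W).map π := by
      intro V W; ext i j; simp [Matrix.mul_apply]
    rw [Unitary.mem_iff, hs, hm, hm, h1, h2]
    simp [Matrix.map_one]

theorem scalarConj_map (F : GL (Fin m) ℂ) (U : Matrix (Fin m) (Fin m) H) :
    (scalarConj F U).map π = scalarConj F (U.map π) := by
  ext i j : 2
  simp [scalarConj]

theorem IsCorepMatrix.leftCoact (hU : IsCorepMatrix U) (i j : Fin m) :
    leftCoact π (U i j) = ∑ k, π (U i k) ⊗ₜ U k j := by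
  simp [BraidedQG.leftCoact, hU.comul_eq]

theorem IsCorepMatrix.biCoact (hU : IsCorepMatrix U) (i j : Fin m) :
    biCoact π (U i j) = ∑ k, ∑ l, U k l ⊗ₜ (π (U i k) ⊗ₜ π (U l j)) := by
  simp [BraidedQG.biCoact, BraidedQG.leftCoact, BraidedQG.rightCoact, hU.comul_eq,
    TensorProduct.tmul_sum]

theorem IsCorepMatrix.weightMap (hU : IsCorepMatrix U) (f : Γ → Γ → ℂ) (i j : Fin m) :
    weightMap π f (U i j) =
      ∑ k, ∑ l, bilinExtend f (π (U i k)) (π (U l j)) • U k l := by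
  simp [weightMap_eq, hU.biCoact]

variable (β : Γ →* Γ →* Circle) [StarRing H] [StarModule ℂ H]

theorem IsCorepMatrix.definesComodule (hU : IsCorepMatrix U) :
    DefinesComodule (transmutation π β) (U.map π) U where
  base := (hU.map π).isRightComodule
  comodule := hU.isRightComodule
  colinear x := by
    induction x using pi_single_induction with
    | zero => simp
    | add x y hx hy => simp only [map_add, hx, hy]
    | smul c x hx => simp only [map_smul, hx]
    | single j =>
      -- The adjoint coaction of `u_{ij}` produces a factor `S(z_{ip})`, which meets `z_{ki}` from
      -- the coaction on `e_i`. Summing over `i` leaves only `k = p`.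
      have hS : ∀ k p, ∑ i, π (U k i) * HopfAlgebra.antipode ℂ (π (U i p)) =
          if k = p then 1 else 0 := fun k p => by
        simpa [Matrix.mul_apply, Matrix.one_apply] using congr($((hU.map π).mul_antipode) k p)
      have h : ∀ i, tensorCoact (matrixCoact (U.map π)) (transCoact π)
          (Pi.single i 1 ⊗ₜ U i j) = ∑ p, ∑ l, ∑ k, (Pi.single k (1 : ℂ) ⊗ₜ U p l) ⊗ₜ
            ((π (U k i) * HopfAlgebra.antipode ℂ (π (U i p))) * π (U l j)) := by
        intro i
        simp [tensorCoact, matrixCoact_single, transCoact_eq, hU.biCoact, TensorProduct.sum_tmul,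
          TensorProduct.tmul_sum, mul_assoc]
      change _ = tensorCoact (matrixCoact (U.map π)) (transCoact π) _
      simp only [matrixCoact_single, map_sum, LinearMap.rTensor_tmul, h, TensorProduct.sum_tmul,
        Matrix.map_apply]
      symm
      calc _ = ∑ p, ∑ l, ∑ k, ∑ i, (Pi.single k (1 : ℂ) ⊗ₜ U p l) ⊗ₜ
            ((π (U k i) * HopfAlgebra.antipode ℂ (π (U i p))) * π (U l j)) := by
            rw [Finset.sum_comm]
            refine Finset.sum_congr rfl fun p _ => ?_
            rw [Finset.sum_comm]
            exact Finset.sum_congr rfl fun l _ => Finset.sum_comm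
        _ = ∑ p, ∑ l, (Pi.single p (1 : ℂ) ⊗ₜ U p l) ⊗ₜ π (U l j) := by
            refine Finset.sum_congr rfl fun p _ => Finset.sum_congr rfl fun l _ => ?_
            simp only [← TensorProduct.tmul_sum, ← Finset.sum_mul, hS]
            simp [apply_ite, ite_mul]
        _ = _ := Finset.sum_comm

end Corep

/-! ### Unitarity, the conjugate matrix and generation -/

section Main

variable {H : Type u} [Ring H] [HopfAlgebra ℂ H] {m : ℕ} {U : Matrix (Fin m) (Fin m) H}
  {Γ : Type v} [CommGroup Γ] (π : H →ₐc[ℂ] MonoidAlgebra ℂ Γ)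
  (β : Γ →* Γ →* Circle) [StarRing H] [StarModule ℂ H]

/-- Moving `x` past the group element `c` costs `β(a⁻¹b, c)`, the inverse of the scalar in the
transmuted product. The original product therefore reappears inside the smash product. -/
theorem smash_mul_leftCoact (x y : H) :
    (smash (bicharForm β) (transmutation π β).toComoduleStarAlgebraData).mul
      (leftCoact π x ⊗ₜ leftCoact π y) = leftCoact π (x * y) := by
  induction x using homogeneous_induction π with
  | add x x' hx hx' => simp only [TensorProduct.add_tmul, map_add, hx, hx', add_mul]
  | homogeneous a b x hx =>
  induction y using homogeneous_induction π with
  | add x x' hx hx' => simp only [TensorProduct.tmul_add, map_add, hx, hx', mul_add]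
  | homogeneous c d y hy =>
  rw [hx.left, hy.left, (hx.mul hy).left, smash,
    braidedTensor_mul_of_degree β hx.transCoact (comul_single_one c)]
  change _ • (LinearMap.mul' ℂ _ _ ⊗ₜ transMul π β (x ⊗ₜ y)) = _
  rw [hx.transMul β hy, LinearMap.mul'_apply, MonoidAlgebra.single_mul_single, mul_one,
    TensorProduct.tmul_smul, smul_smul]
  conv_rhs => rw [← one_smul ℂ (_ ⊗ₜ[ℂ] _)]
  congr 1
  simp only [map_mul, map_inv, MonoidHom.mul_apply, MonoidHom.inv_apply,
    Circle.coe_mul, Circle.coe_inv]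
  field_simp

/-- The same cancellation: `β(ab⁻¹, a⁻¹)` from the braiding against `β(a⁻¹b, a⁻¹)` from the
transmuted involution. -/
theorem smash_star_leftCoact (hH : IsHopfStar H) (hπ : ∀ x, π (star x) = star (π x)) (x : H) :
    (smash (bicharForm β) (transmutation π β).toComoduleStarAlgebraData).star
      (leftCoact π x) = leftCoact π (star x) := by
  induction x using homogeneous_induction π with
  | add x x' hx hx' => simp only [map_add, hx, hx', star_add]
  | homogeneous a b x hx =>
  have h1 : transCoact π (transStar π β x) =
      transStar π β x ⊗ₜ MonoidAlgebra.single (a⁻¹⁻¹ * b⁻¹) 1 := by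
    rw [hx.transStar, map_smul, (hx.star hH hπ).transCoact, TensorProduct.smul_tmul']
  have h2 : star (MonoidAlgebra.single a (1 : ℂ)) = MonoidAlgebra.single a⁻¹ 1 := by
    simp [star_single]
  have h3 : Coalgebra.comul (R := ℂ) (star (MonoidAlgebra.single a (1 : ℂ))) =
      star (MonoidAlgebra.single a (1 : ℂ)) ⊗ₜ MonoidAlgebra.single a⁻¹ 1 := by
    rw [h2, comul_single_one]
  rw [hx.left, (hx.star hH hπ).left, smash, braidedTensor_star_of_degree β h1 h3]
  change _ • (star (MonoidAlgebra.single a (1 : ℂ)) ⊗ₜ transStar π β x) = _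
  rw [h2, hx.transStar, TensorProduct.tmul_smul, smul_smul]
  conv_rhs => rw [← one_smul ℂ (_ ⊗ₜ[ℂ] _)]
  congr 1
  simp only [map_mul, map_inv, MonoidHom.mul_apply, MonoidHom.inv_apply,
    Circle.coe_mul, Circle.coe_inv, inv_inv]
  field_simp

/-- The entries of `π(U) # U` are the images of the `u_{ij}` under the left coaction, which carries
the unitarity relations of `ℂ[G]` into the smash product. The matrix need not be the fundamental
one; it is later taken to be `F Ū F⁻¹`. -/
theorem IsUnitaryCorepMatrix.definesUnitaryComodule (hH : IsHopfStar H)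
    (hπ : ∀ x, π (star x) = star (π x)) (hU : IsUnitaryCorepMatrix U) :
    DefinesUnitaryComodule (bicharForm β) (transmutation π β) (U.map π) U where
  toDefinesComodule := hU.toIsCorepMatrix.definesComodule π β
  unitary := by
    have hs : ∀ i j, smashMatrix (U.map π) U i j = leftCoact π (U i j) := fun i j =>
      (hU.toIsCorepMatrix.leftCoact π i j).symm
    have h1 : leftCoact π (1 : H) =
        (smash (bicharForm β) (transmutation π β).toComoduleStarAlgebraData).one :=
      map_one (leftCoactHom π)
    constructor
    · intro i j
      simp only [hs, smash_star_leftCoact π β hH hπ, smash_mul_leftCoact, ← map_sum]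
      have h := congr($(Unitary.star_mul_self_of_mem hU.mem_unitary) i j)
      simp only [Matrix.mul_apply, Matrix.star_apply, Matrix.one_apply] at h
      rw [h, ← h1]
      split_ifs <;> simp
    · intro i j
      simp only [hs, smash_star_leftCoact π β hH hπ, smash_mul_leftCoact, ← map_sum]
      have h := congr($(Unitary.mul_star_self_of_mem hU.mem_unitary) i j)
      simp only [Matrix.mul_apply, Matrix.star_apply, Matrix.one_apply] at h
      rw [h, ← h1]
      split_ifs <;> simp

theorem star_eq_transStar_weightMap (x : H) :
    star x = transStar π β (weightMap π (fun a b => (β (a⁻¹ * b) a⁻¹ : ℂ)) x) := by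
  induction x using homogeneous_induction π with
  | add x x' hx hx' => simp only [map_add, hx, hx', star_add]
  | homogeneous a b x hx =>
  rw [hx.weightMap, LinearMap.map_smulₛₗ, hx.transStar, smul_smul, star_bichar, ← Circle.coe_mul,
    inv_mul_cancel, Circle.coe_one, one_smul]

/-- On group elements `w = c` and `y = b`, both sides are `β(b⁻¹c, c⁻¹)`. The left side is the
coordinate-free form of the sum over `l` in the entries of `Ū_Z`. -/
theorem conjMatrix_coefficient (w y : MonoidAlgebra ℂ Γ) :
    TensorProduct.lift ((bicharForm β ∘ₗ LinearMap.mulLeft ℂ (star y)).compl₂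
      (HopfAlgebra.antipode ℂ (A := MonoidAlgebra ℂ Γ))) (Coalgebra.comul (R := ℂ) w) =
    star (bilinExtend (fun a b => (β (a⁻¹ * b) a⁻¹ : ℂ)) (star (HopfAlgebra.antipode ℂ w)) y) := by
  induction w using groupAlgebra_induction with
  | add w w' hw hw' => simp only [map_add, hw, hw', star_add, LinearMap.add_apply]
  | smul c w hw => simp only [map_smul, hw, star_smul, LinearMap.smul_apply, star_star]
  | single c =>
  rw [comul_single_one, TensorProduct.lift.tmul, antipode_single_one, star_single, inv_inv,
    star_one, LinearMap.compl₂_apply, antipode_single_one, LinearMap.comp_apply,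
    LinearMap.mulLeft_apply]
  induction y using groupAlgebra_induction with
  | add w w' hw hw' =>
    simp only [map_add, hw, hw', star_add, LinearMap.add_apply, add_mul]
  | smul r w hw =>
    simp only [map_smul, hw, star_smul, LinearMap.smul_apply, smul_mul_assoc]
  | single b =>
  rw [bilinExtend_single, star_single, star_one, MonoidAlgebra.single_mul_single, mul_one,
    bicharForm_single, RCLike.star_def, star_bichar]
  simp [mul_comm]

/-- The conjugate matrix in the transmutation is the entrywise adjoint in the original algebra. -/
theorem IsUnitaryCorepMatrix.conjMatrix_eq (hπ : ∀ x, π (star x) = star (π x))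
    (hU : IsUnitaryCorepMatrix U) :
    conjMatrix (bicharForm β) (transmutation π β).toComoduleStarAlgebraData (U.map π) U =
      U.map star := by
  have hZ := hU.map π hπ
  ext i j
  rw [Matrix.map_apply, star_eq_transStar_weightMap π β, hU.toIsCorepMatrix.weightMap]
  simp only [conjMatrix, map_sum, LinearMap.map_smulₛₗ]
  refine Finset.sum_congr rfl fun s _ => ?_
  rw [Finset.sum_comm]
  refine Finset.sum_congr rfl fun t _ => ?_
  rw [← Finset.sum_smul]
  congr 1
  -- With `w = z_{si}`, the coproduct creates the sum over `l`, and `S(z_{li}) = z_{il}^*` by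
  -- unitarity of `Z`.
  have h := conjMatrix_coefficient β ((U.map π) s i) (π (U t j))
  rw [hZ.antipode_eq, star_star, hZ.comul_eq] at h
  simp only [map_sum, TensorProduct.lift.tmul, LinearMap.compl₂_apply, LinearMap.comp_apply,
    LinearMap.mulLeft_apply, hZ.antipode_eq] at h
  exact h

/-- A subspace closed under the transmuted operations need not visibly be closed under the original
ones, since the scalars vary with the bidegree. The span of its homogeneous elements is closed under
them, and it still contains the generators. -/
theorem transmutation_generates (hH : IsHopfStar H) (hπ : ∀ x, π (star x) = star (π x))
    (hU : IsCorepMatrix U)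
    (hgen : StarAlgebra.adjoin ℂ (Set.range fun p : Fin m × Fin m => U p.1 p.2) = ⊤) :
    GeneratesStarAlgebra (transmutation π β).toComoduleStarAlgebraData U := by
  intro S hone hmem hmul hstar
  change (1 : H) ∈ S at hone
  replace hmul : ∀ a ∈ S, ∀ b ∈ S, transMul π β (a ⊗ₜ b) ∈ S := hmul
  replace hstar : ∀ a ∈ S, transStar π β a ∈ S := hstar
  set S' : Submodule ℂ H := Submodule.span ℂ {x | x ∈ S ∧ ∃ a b, IsHomogeneous π a b x} with hS'
  have hle : S' ≤ S := Submodule.span_le.2 fun x hx => hx.1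
  have hone' : (1 : H) ∈ S' := Submodule.subset_span ⟨hone, 1, 1, isHomogeneous_one⟩
  have hmul' : ∀ x ∈ S', ∀ y ∈ S', x * y ∈ S' := by
    intro x hx y hy
    induction hx using Submodule.span_induction with
    | zero => simp
    | add s s' _ _ hs hs' => rw [add_mul]; exact add_mem hs hs'
    | smul r s _ hs => rw [smul_mul_assoc]; exact S'.smul_mem r hs
    | mem x hx =>
      obtain ⟨hxS, a, b, hx⟩ := hx
      induction hy using Submodule.span_induction with
      | zero => simp
      | add s s' _ _ hs hs' => rw [mul_add]; exact add_mem hs hs'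
      | smul r s _ hs => rw [mul_smul_comm]; exact S'.smul_mem r hs
      | mem y hy =>
        obtain ⟨hyS, c, d, hy⟩ := hy
        refine Submodule.subset_span ⟨?_, _, _, hx.mul hy⟩
        have h := hmul x hxS y hyS
        rw [hx.transMul β hy] at h
        exact (S.smul_mem_iff (Circle.coe_ne_zero _)).1 h
  have hstar' : ∀ x ∈ S', star x ∈ S' := by
    intro x hx
    induction hx using Submodule.span_induction with
    | zero => simp
    | add s s' _ _ hs hs' => rw [star_add]; exact add_mem hs hs'
    | smul r s _ hs => rw [star_smul]; exact S'.smul_mem _ hs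
    | mem x hx =>
      obtain ⟨hxS, a, b, hx⟩ := hx
      refine Submodule.subset_span ⟨?_, _, _, hx.star hH hπ⟩
      have h := hstar x hxS
      rw [hx.transStar] at h
      exact (S.smul_mem_iff (Circle.coe_ne_zero _)).1 h
  have hleft : ∀ a i j, leftProj π a (U i j) = ∑ k, coeffAt a (π (U i k)) • U k j := by
    intro a i j
    simp [leftProj_eq, hU.leftCoact]
  have hright : ∀ b i j, rightProj π b (U i j) = ∑ k, coeffAt b (π (U k j)) • U i k := by
    intro b i j
    simp [rightProj, rightAct, hU.comul_eq]
  -- Projecting `u_{ij}` on either side only replaces it by a linear combination of entries of `U`,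
  -- so its homogeneous components stay in `S`.
  have hmem' : ∀ i j, U i j ∈ S' := by
    intro i j
    obtain ⟨F, G, h⟩ := exists_eq_sum_leftProj_rightProj π (U i j)
    rw [h]
    refine sum_mem fun b _ => sum_mem fun a _ => Submodule.subset_span
      ⟨?_, a, b, isHomogeneous_leftProj_rightProj π a b _⟩
    simp only [hright, map_sum, map_smul, hleft]
    exact sum_mem fun k _ => S.smul_mem _ (sum_mem fun l _ => S.smul_mem _ (hmem l k))
  refine eq_top_iff.2 fun x hx => hle ?_
  clear hx
  have hx : x ∈ StarAlgebra.adjoin ℂ (Set.range fun p : Fin m × Fin m => U p.1 p.2) := by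
    rw [hgen]; exact StarSubalgebra.mem_top
  induction hx using StarAlgebra.adjoin_induction with
  | mem x hx =>
    obtain ⟨p, rfl⟩ := hx
    exact hmem' p.1 p.2
  | algebraMap r => rw [Algebra.algebraMap_eq_smul_one]; exact S'.smul_mem r hone'
  | add x y _ _ hx hy => exact add_mem hx hy
  | mul x y _ _ hx hy => exact hmul' x hx y hy
  | star x _ hx => exact hstar' x hx

end Main

end BraidedQG
end

theorem mainTheorem5 {H : Type*} [Ring H] [HopfAlgebra ℂ H] [StarRing H] [StarModule ℂ H]
    {m : ℕ} (U : Matrix (Fin m) (Fin m) H)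
    (hG : BraidedQG.IsCompactMatrixQuantumGroup U)
    {T : Type*} [CommGroup T] [TopologicalSpace T] [IsTopologicalGroup T] [CompactSpace T]
    [T2Space T]
    (π : H →ₐc[ℂ] BraidedQG.FunctionAlgebra T) (hπ : ∀ x, π (star x) = star (π x))
    (β : PontryaginDual T →* PontryaginDual T →* Circle) :
    BraidedQG.IsBraidedCompactMatrixQuantumGroup (U.map π) β
      (BraidedQG.transmutation π β) U := by
  have hU := hG.unitary_corep
  have hmap : (U.map π).map star = (U.map star).map π := by
    refine Matrix.ext fun i j => ?_
    exact (hπ _).symm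
  refine ⟨hU.map π hπ, BraidedQG.transmutation_isBraidedHopfStarAlgebra π β hG.hopfStar hπ,
    BraidedQG.transmutation_generates π β hG.hopfStar hπ hU.toIsCorepMatrix hG.generates,
    hU.definesUnitaryComodule π β hG.hopfStar hπ, ?_⟩
  rw [hU.conjMatrix_eq π β hπ, hmap]
  obtain ⟨F, hF⟩ := hG.conj_equiv_unitary
  refine ⟨(hU.toIsCorepMatrix.map_star hG.hopfStar).definesComodule π β, F, ?_⟩
  -- As `π` is linear, conjugating `Z̄` by `F` gives the image under `π` of the unitary
  -- corepresentation matrix `F Ū F⁻¹`.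
  rw [← BraidedQG.scalarConj_map]
  exact hF.definesUnitaryComodule π β hG.hopfStar hπ
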